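/- Let $\kappa\in\mathbb R$ and let $(M,d)$ be a $\mathrm{CAT}(\kappa)$ space. For a Borel probability measure $\mu$ on $M$ let $F(q)=\frac12\int_M d(q,x)^2\,\mu(dx)$ be its Fréchet function; a Fréchet mean of $\mu$ is a minimizer of $F$, where $F$ is assumed finite. Assume that $\mu$ is localized: it has a unique Fréchet mean $b$, the function $F$ is convex in a neighborhood of $b$, and $\mu$-almost every $x\in M$ is joined to $b$ by a unique shortest path. Assume also that $M$ is complete, geodesic and locally compact, or that $d(b,x)<\pi/\sqrt\kappa$ for $\mu$-almost every $x$ (this second condition is void, hence automatic, if $\kappa\le 0$). Let $S_bM$ be the space of directions at $b$, that is, the set of unit-speed geodesics emanating from $b$ modulo the relation of having Alexandrov angle $0$, and let $T_bM=S_bM\times[0,\infty)/S_bM\times\{0\}$ be the tangent cone (just the apex if $S_bM$ is empty). Write $\|V\|$ for the length of $V\in T_bM$ and $\angle(V,W)\in[0,\pi]$ for the angle between $V$ and $W$, and equip $T_bM$ with the conical metric $\sqrt{\|V\|^2+\|W\|^2-2\|V\|\|W\|\cos\angle(V,W)}$. Let $\log_b$ be the ($\mu$-almost surely defined) logarithm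 map, sending $x$ to the vector of length $d(b,x)$ in the direction of the unique shortest path from $b$ to $x$. For $V\in T_bM$ let $\nabla_bF(V)=\frac{d}{dt}F(\exp_b tV)|_{t=0^+}$ be the directional derivative of $F$ at $b$. Define the escape cone $E_\mu=\{V\in T_bM\mid\nabla_bF(V)=0\}$, and the fluctuating cone $C_\mu=E_\mu\cap\operatorname{hull}\mu$, where $\operatorname{hull}\mu$ is the smallest geodesically convex cone in $T_bM$ containing the support of the pushforward measure $(\log_b)_\sharp\mu$. If $Z\in E_\mu$ is a unit vector, then there is at most one unit vector $X\in C_\mu$ with $\angle(Z,X)\ge\pi$. -/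

import Mathlib

open Set Filter Topology MeasureTheory

noncomputable section

namespace FrechetGeometry

/-! ### Geodesics and `CAT(κ)` spaces -/

/-- `γ`, restricted to `[0, dist x y]`, is a shortest path from `x` to `y` parametrized by
arclength. -/
structure IsShortestPath {M : Type*} [MetricSpace M] (γ : ℝ → M) (x y : M) : Prop where
  source : γ 0 = x
  target : γ (dist x y) = y
  isom : ∀ s ∈ Icc 0 (dist x y), ∀ t ∈ Icc 0 (dist x y), dist (γ s) (γ t) = |s - t|

/-- There is exactly one shortest path from `x` to `y`. -/
def HasUniqueShortestPath {M : Type*} [MetricSpace M] (x y : M) : Prop :=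
  ∃ γ : ℝ → M, IsShortestPath γ x y ∧
    ∀ γ' : ℝ → M, IsShortestPath γ' x y → EqOn γ' γ (Icc 0 (dist x y))

/-- Any two points are joined by a shortest path. -/
def IsGeodesicSpace (M : Type*) [MetricSpace M] : Prop :=
  ∀ x y : M, ∃ γ : ℝ → M, IsShortestPath γ x y

/-- In a model plane `P` with distance function `D`, there are a triangle `x' y' z'` with the same
side lengths as `x y z`, a point `p'` on the side `x' y'` corresponding to `p` and a point `q'` on
the side `x' z'` corresponding to `q`, such that `p` and `q` are no further apart than `p'`
and `q'`. -/
def ComparisonIn {M : Type*} [MetricSpace M] {P : Type} (D : P → P → ℝ) (x y z p q : M) : Prop :=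
  ∃ x' y' z' p' q' : P,
    D x' y' = dist x y ∧ D y' z' = dist y z ∧ D x' z' = dist x z ∧
    D x' p' = dist x p ∧ D p' y' = dist p y ∧
    D x' q' = dist x q ∧ D q' z' = dist q z ∧
    dist p q ≤ D p' q'

/-- `M` is a `CAT(κ)` space: points at distance less than `π / √κ` (any two points if `κ ≤ 0`) are
joined by a shortest path, and geodesic triangles of perimeter less than `2π / √κ` (all of them if
`κ ≤ 0`) are at least as thin as the comparison triangles in the plane of constant curvature `κ`:
the hyperbolic plane rescaled by `1 / √(-κ)`, the Euclidean plane, or the round sphere of radius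
`1 / √κ` with its great-circle distance. That `p` lies on a side `x y` of the triangle is expressed
by `dist x p + dist p y = dist x y`. -/
structure IsCAT (κ : ℝ) (M : Type*) [MetricSpace M] : Prop where
  exists_shortestPath : ∀ x y : M, (0 < κ → dist x y < Real.pi / √κ) →
    ∃ γ : ℝ → M, IsShortestPath γ x y
  comparison : ∀ x y z p q : M,
    (0 < κ → dist x y + dist y z + dist x z < 2 * (Real.pi / √κ)) →
    dist x p + dist p y = dist x y → dist x q + dist q z = dist x z →
    (κ < 0 → ComparisonIn (fun u v : UpperHalfPlane => dist u v / √(-κ)) x y z p q) ∧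
    (κ = 0 → ComparisonIn (fun u v : EuclideanSpace ℝ (Fin 2) => dist u v) x y z p q) ∧
    (0 < κ → ComparisonIn
      (fun u v : Metric.sphere (0 : EuclideanSpace ℝ (Fin 3)) 1 =>
        InnerProductGeometry.angle (u : EuclideanSpace ℝ (Fin 3)) v / √κ) x y z p q)

/-! ### Angles and the space of directions -/

/-- A geodesic emanating from `p`, parametrized by arclength on some interval `[0, ε)`; the values
outside this interval play no role. -/
structure UnitGeodesic {M : Type*} [MetricSpace M] (p : M) where
  toFun : ℝ → M
  source : toFun 0 = p
  isom : ∃ ε > 0, ∀ s ∈ Ico 0 ε, ∀ t ∈ Ico 0 ε, dist (toFun s) (toFun t) = |s - t|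

section Angle

variable {M : Type*} [MetricSpace M] {p : M}

/-- The cosine of the Euclidean comparison angle at `p` for the points `γ₁ s` and `γ₂ t`. -/
def comparisonCos (γ₁ γ₂ : UnitGeodesic p) (st : ℝ × ℝ) : ℝ :=
  (st.1 ^ 2 + st.2 ^ 2 - dist (γ₁.toFun st.1) (γ₂.toFun st.2) ^ 2) / (2 * st.1 * st.2)

/-- The filter of pairs `(s, t)` of positive reals that tend to `(0, 0)`. -/
def smallPairs : Filter (ℝ × ℝ) := 𝓝[>] (0 : ℝ) ×ˢ 𝓝[>] (0 : ℝ)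

/-- The Alexandrov angle between geodesics emanating from `p`. Its cosine is the limit of the
comparison cosines as `s, t → 0`, which always exists in `CAT(κ)` spaces; writing it as a lower
limit makes sense in every metric space. -/
def geodesicAngle (γ₁ γ₂ : UnitGeodesic p) : ℝ :=
  Real.arccos (liminf (comparisonCos γ₁ γ₂) smallPairs)

instance : smallPairs.NeBot := by unfold smallPairs; infer_instance

theorem UnitGeodesic.exists_dist_source (γ : UnitGeodesic p) :
    ∃ ε > 0, ∀ s ∈ Ioo 0 ε, dist (γ.toFun s) p = s := by
  obtain ⟨ε, hε, h⟩ := γ.isom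
  refine ⟨ε, hε, fun s hs => ?_⟩
  have := h s ⟨hs.1.le, hs.2⟩ 0 ⟨le_rfl, hε⟩
  rwa [γ.source, sub_zero, abs_of_pos hs.1] at this

theorem eventually_smallPairs {P : ℝ × ℝ → Prop} :
    (∀ᶠ st in smallPairs, P st) ↔
      ∃ ε > 0, ∀ s ∈ Ioo (0 : ℝ) ε, ∀ t ∈ Ioo (0 : ℝ) ε, P (s, t) := by
  have hb := (nhdsGT_basis (0 : ℝ)).prod_self
  unfold smallPairs
  rw [hb.eventually_iff]
  constructor
  · rintro ⟨ε, hε, h⟩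
    exact ⟨ε, hε, fun s hs t ht => h ⟨hs, ht⟩⟩
  · rintro ⟨ε, hε, h⟩
    exact ⟨ε, hε, fun st hst => h st.1 hst.1 st.2 hst.2⟩

theorem eventually_abs_comparisonCos_le (γ₁ γ₂ : UnitGeodesic p) :
    ∀ᶠ st in smallPairs, |comparisonCos γ₁ γ₂ st| ≤ 1 := by
  obtain ⟨ε₁, h₁, H₁⟩ := γ₁.exists_dist_source
  obtain ⟨ε₂, h₂, H₂⟩ := γ₂.exists_dist_source
  rw [eventually_smallPairs]
  refine ⟨min ε₁ ε₂, lt_min h₁ h₂, fun s hs t ht => ?_⟩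
  have hs' := H₁ s ⟨hs.1, hs.2.trans_le (min_le_left _ _)⟩
  have ht' := H₂ t ⟨ht.1, ht.2.trans_le (min_le_right _ _)⟩
  have hs0 := hs.1
  have ht0 := ht.1
  have k₁ := dist_triangle_right (γ₁.toFun s) (γ₂.toFun t) p
  have k₂ := dist_triangle (γ₁.toFun s) (γ₂.toFun t) p
  have k₃ := dist_triangle_left (γ₂.toFun t) p (γ₁.toFun s)
  rw [hs', ht'] at k₁ k₂
  rw [hs', ht'] at k₃
  have k₀ : 0 ≤ dist (γ₁.toFun s) (γ₂.toFun t) := dist_nonneg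
  have hst : 0 < 2 * s * t := by positivity
  unfold comparisonCos
  rw [abs_le]
  constructor
  · rw [le_div_iff₀ hst]
    nlinarith
  · rw [div_le_iff₀ hst]
    have : (s - t) ^ 2 ≤ dist (γ₁.toFun s) (γ₂.toFun t) ^ 2 := by
      apply sq_le_sq'
      · linarith
      · linarith
    nlinarith

theorem isBoundedUnder_ge_comparisonCos (γ₁ γ₂ : UnitGeodesic p) :
    IsBoundedUnder (· ≥ ·) smallPairs (comparisonCos γ₁ γ₂) :=
  ⟨-1, by
    rw [eventually_map]
    exact (eventually_abs_comparisonCos_le γ₁ γ₂).mono fun _ h => (abs_le.1 h).1⟩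

theorem isCoboundedUnder_ge_comparisonCos (γ₁ γ₂ : UnitGeodesic p) :
    IsCoboundedUnder (· ≥ ·) smallPairs (comparisonCos γ₁ γ₂) :=
  IsBoundedUnder.isCoboundedUnder_ge ⟨1, by
    rw [eventually_map]
    exact (eventually_abs_comparisonCos_le γ₁ γ₂).mono fun _ h => (abs_le.1 h).2⟩

theorem cos_geodesicAngle (γ₁ γ₂ : UnitGeodesic p) :
    Real.cos (geodesicAngle γ₁ γ₂) = liminf (comparisonCos γ₁ γ₂) smallPairs := by
  apply Real.cos_arccos
  · exact le_liminf_of_le (isCoboundedUnder_ge_comparisonCos γ₁ γ₂)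
      ((eventually_abs_comparisonCos_le γ₁ γ₂).mono fun _ h => (abs_le.1 h).1)
  · exact liminf_le_of_le (isBoundedUnder_ge_comparisonCos γ₁ γ₂) fun b hb => by
      obtain ⟨st, h₁, h₂⟩ := (hb.and (eventually_abs_comparisonCos_le γ₁ γ₂)).exists
      exact h₁.trans (abs_le.1 h₂).2

theorem geodesicAngle_nonneg (γ₁ γ₂ : UnitGeodesic p) : 0 ≤ geodesicAngle γ₁ γ₂ :=
  Real.arccos_nonneg _

theorem geodesicAngle_le_pi (γ₁ γ₂ : UnitGeodesic p) : geodesicAngle γ₁ γ₂ ≤ Real.pi :=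
  Real.arccos_le_pi _

theorem geodesicAngle_self (γ : UnitGeodesic p) : geodesicAngle γ γ = 0 := by
  have h : ∀ᶠ st in smallPairs, comparisonCos γ γ st = 1 := by
    obtain ⟨ε, hε, H⟩ := γ.isom
    rw [eventually_smallPairs]
    refine ⟨ε, hε, fun s hs t ht => ?_⟩
    have hs0 := hs.1
    have ht0 := ht.1
    simp only [comparisonCos]
    rw [H s ⟨hs.1.le, hs.2⟩ t ⟨ht.1.le, ht.2⟩, sq_abs]
    field_simp
    ring
  unfold geodesicAngle
  rw [liminf_congr h, liminf_const, Real.arccos_one]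

theorem geodesicAngle_comm (γ₁ γ₂ : UnitGeodesic p) :
    geodesicAngle γ₁ γ₂ = geodesicAngle γ₂ γ₁ := by
  have h : comparisonCos γ₁ γ₂ = comparisonCos γ₂ γ₁ ∘ Prod.swap := by
    funext st
    simp only [comparisonCos, Function.comp, Prod.fst_swap, Prod.snd_swap]
    rw [dist_comm]
    ring
  have h' : Filter.map Prod.swap smallPairs = smallPairs := by
    unfold smallPairs
    rw [← Filter.prod_comm]
  unfold geodesicAngle
  congr 1
  calc liminf (comparisonCos γ₁ γ₂) smallPairs
      = liminf (comparisonCos γ₂ γ₁) (Filter.map Prod.swap smallPairs) := by rw [h]; rfl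
    _ = liminf (comparisonCos γ₂ γ₁) smallPairs := by rw [h']

/-- Above the angle, the comparison triangles are eventually thinner than the Euclidean ones. -/
theorem eventually_dist_sq_lt {γ₁ γ₂ : UnitGeodesic p} {θ : ℝ} (h : geodesicAngle γ₁ γ₂ < θ)
    (hθ : θ ≤ Real.pi) :
    ∀ᶠ st in smallPairs, dist (γ₁.toFun st.1) (γ₂.toFun st.2) ^ 2 <
      st.1 ^ 2 + st.2 ^ 2 - 2 * st.1 * st.2 * Real.cos θ := by
  have hc : Real.cos θ < liminf (comparisonCos γ₁ γ₂) smallPairs := by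
    rw [← cos_geodesicAngle]
    exact Real.cos_lt_cos_of_nonneg_of_le_pi (geodesicAngle_nonneg _ _) hθ h
  have h1 := eventually_lt_of_lt_liminf hc (isBoundedUnder_ge_comparisonCos γ₁ γ₂)
  have h2 : ∀ᶠ st in smallPairs, 0 < st.1 ∧ 0 < st.2 := by
    rw [eventually_smallPairs]
    exact ⟨1, one_pos, fun s hs t ht => ⟨hs.1, ht.1⟩⟩
  filter_upwards [h1, h2] with st hst hpos
  have : 0 < 2 * st.1 * st.2 := by have := hpos.1; have := hpos.2; positivity
  unfold comparisonCos at hst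
  rw [lt_div_iff₀ this] at hst
  linarith

/-- In the Euclidean plane, the segment between the endpoints of two sides `s`, `t` at angle `α + β`
crosses the ray at angle `α` from the first side at distance `r` from the vertex. -/
theorem planar_split {s t α β : ℝ} (hs : 0 < s) (ht : 0 < t) (hα : 0 < α) (hβ : 0 < β)
    (hαβ : α + β < Real.pi) :
    ∃ r l D : ℝ, 0 < r ∧ r ≤ max s t ∧ 0 ≤ l ∧ l ≤ 1 ∧ 0 ≤ D ∧
      D ^ 2 = s ^ 2 + t ^ 2 - 2 * s * t * Real.cos (α + β) ∧
      s ^ 2 + r ^ 2 - 2 * s * r * Real.cos α = ((1 - l) * D) ^ 2 ∧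
      r ^ 2 + t ^ 2 - 2 * r * t * Real.cos β = (l * D) ^ 2 := by
  have hsinα : 0 < Real.sin α := Real.sin_pos_of_pos_of_lt_pi hα (by linarith)
  have hsinβ : 0 < Real.sin β := Real.sin_pos_of_pos_of_lt_pi hβ (by linarith)
  have hsinαβ : 0 < Real.sin (α + β) := Real.sin_pos_of_pos_of_lt_pi (by linarith) hαβ
  have hden : 0 < s * Real.sin α + t * Real.sin β := by positivity
  obtain ⟨l, hl⟩ : ∃ l, l = t * Real.sin β / (s * Real.sin α + t * Real.sin β) := ⟨_, rfl⟩
  have hl0 : 0 < l := by rw [hl]; positivity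
  have hl1 : l < 1 := by
    rw [hl, div_lt_one hden]
    have : 0 < s * Real.sin α := by positivity
    linarith
  have h1l : 0 < 1 - l := by linarith
  have hbal : l * s * Real.sin α = (1 - l) * t * Real.sin β := by
    rw [hl]; field_simp; ring
  obtain ⟨r, hr⟩ : ∃ r, r = l * s * Real.cos α + (1 - l) * t * Real.cos β := ⟨_, rfl⟩
  have hrs : r * Real.sin α = (1 - l) * t * Real.sin (α + β) := by
    rw [hr, Real.sin_add]; linear_combination Real.cos α * hbal
  have hrc : r * Real.cos α = l * s + (1 - l) * t * Real.cos (α + β) := by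
    rw [hr, Real.cos_add]
    linear_combination (-Real.sin α) * hbal + (l * s) * (Real.sin_sq_add_cos_sq α)
  have hr0 : 0 < r := by
    have : 0 < r * Real.sin α := by rw [hrs]; positivity
    exact pos_of_mul_pos_left this hsinα.le
  have hrη : r ≤ max s t := by
    have k₁ : l * s * Real.cos α ≤ l * s :=
      mul_le_of_le_one_right (by positivity) (Real.cos_le_one α)
    have k₂ : (1 - l) * t * Real.cos β ≤ (1 - l) * t :=
      mul_le_of_le_one_right (by positivity) (Real.cos_le_one β)
    have k₃ : l * s ≤ l * max s t := mul_le_mul_of_nonneg_left (le_max_left _ _) hl0.le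
    have k₄ : (1 - l) * t ≤ (1 - l) * max s t :=
      mul_le_mul_of_nonneg_left (le_max_right _ _) h1l.le
    rw [hr]; linarith
  have hE : s ^ 2 + t ^ 2 - 2 * s * t * Real.cos (α + β) =
      (s - t * Real.cos (α + β)) ^ 2 + (t * Real.sin (α + β)) ^ 2 := by
    linear_combination (-t ^ 2) * (Real.sin_sq_add_cos_sq (α + β))
  have hD2 := Real.sq_sqrt
    (show 0 ≤ s ^ 2 + t ^ 2 - 2 * s * t * Real.cos (α + β) by rw [hE]; positivity)
  refine ⟨r, l, √(s ^ 2 + t ^ 2 - 2 * s * t * Real.cos (α + β)), hr0, hrη, hl0.le, hl1.le,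
    Real.sqrt_nonneg _, hD2, ?_, ?_⟩
  · have e : s ^ 2 + r ^ 2 - 2 * s * r * Real.cos α
        = (s - r * Real.cos α) ^ 2 + (r * Real.sin α) ^ 2 := by
      linear_combination (-r ^ 2) * (Real.sin_sq_add_cos_sq α)
    rw [e, mul_pow _ (√_), hD2, hE, hrc, hrs]; ring
  · have hcβ : Real.cos β = Real.cos (α + β) * Real.cos α + Real.sin (α + β) * Real.sin α := by
      rw [← Real.cos_sub]; congr 1; ring
    have e : r ^ 2 + t ^ 2 - 2 * r * t * Real.cos β
        = (r * Real.cos α - t * Real.cos (α + β)) ^ 2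
          + (r * Real.sin α - t * Real.sin (α + β)) ^ 2 := by
      rw [hcβ]
      linear_combination (-r ^ 2) * (Real.sin_sq_add_cos_sq α)
        + (-t ^ 2) * (Real.sin_sq_add_cos_sq (α + β))
    rw [e, mul_pow _ (√_), hD2, hE, hrc, hrs]; ring

theorem geodesicAngle_triangle (γ₁ γ₂ γ₃ : UnitGeodesic p) :
    geodesicAngle γ₁ γ₃ ≤ geodesicAngle γ₁ γ₂ + geodesicAngle γ₂ γ₃ := by
  by_contra! hlt
  have hα0 : 0 ≤ geodesicAngle γ₁ γ₂ := geodesicAngle_nonneg _ _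
  have hβ0 : 0 ≤ geodesicAngle γ₂ γ₃ := geodesicAngle_nonneg _ _
  have hπ : geodesicAngle γ₁ γ₃ ≤ Real.pi := geodesicAngle_le_pi _ _
  obtain ⟨δ, hδ, hδ'⟩ : ∃ δ > 0,
      geodesicAngle γ₁ γ₂ + geodesicAngle γ₂ γ₃ + 4 * δ = geodesicAngle γ₁ γ₃ :=
    ⟨(geodesicAngle γ₁ γ₃ - geodesicAngle γ₁ γ₂ - geodesicAngle γ₂ γ₃) / 4, by linarith, by ring⟩
  obtain ⟨α, hα⟩ : ∃ α, α = geodesicAngle γ₁ γ₂ + δ := ⟨_, rfl⟩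
  obtain ⟨β, hβ⟩ : ∃ β, β = geodesicAngle γ₂ γ₃ + δ := ⟨_, rfl⟩
  have e₁ := eventually_dist_sq_lt (γ₁ := γ₁) (γ₂ := γ₂) (θ := α) (by linarith) (by linarith)
  have e₂ := eventually_dist_sq_lt (γ₁ := γ₂) (γ₂ := γ₃) (θ := β) (by linarith) (by linarith)
  obtain ⟨η₁, hη₁, H₁⟩ := eventually_smallPairs.1 e₁
  obtain ⟨η₂, hη₂, H₂⟩ := eventually_smallPairs.1 e₂
  have hc : liminf (comparisonCos γ₁ γ₃) smallPairs < Real.cos (α + β) := by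
    rw [← cos_geodesicAngle]
    exact Real.cos_lt_cos_of_nonneg_of_le_pi (by linarith) hπ (by linarith)
  have hf := frequently_lt_of_liminf_lt (isCoboundedUnder_ge_comparisonCos γ₁ γ₃) hc
  have hs : ∀ᶠ st in smallPairs,
      st.1 ∈ Ioo 0 (min η₁ η₂) ∧ st.2 ∈ Ioo 0 (min η₁ η₂) :=
    eventually_smallPairs.2 ⟨min η₁ η₂, lt_min hη₁ hη₂, fun s hs t ht => ⟨hs, ht⟩⟩
  obtain ⟨⟨s, t⟩, hst, ⟨hs0, hsη⟩, ⟨ht0, htη⟩⟩ := (hf.and_eventually hs).exists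
  simp only at hs0 hsη ht0 htη
  obtain ⟨r, l, D, hr0, hrm, hl0, hl1, hD0, hD2, f₁, f₂⟩ := planar_split hs0 ht0
    (show 0 < α by linarith) (show 0 < β by linarith) (show α + β < Real.pi by linarith)
  have hrη : r < min η₁ η₂ := hrm.trans_lt (max_lt hsη htη)
  have d₁ := H₁ s ⟨hs0, hsη.trans_le (min_le_left _ _)⟩ r ⟨hr0, hrη.trans_le (min_le_left _ _)⟩
  have d₂ := H₂ r ⟨hr0, hrη.trans_le (min_le_right _ _)⟩ t ⟨ht0, htη.trans_le (min_le_right _ _)⟩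
  simp only at d₁ d₂
  rw [f₁] at d₁
  rw [f₂] at d₂
  have g₁ := lt_of_pow_lt_pow_left₀ 2 (mul_nonneg (by linarith) hD0) d₁
  have g₂ := lt_of_pow_lt_pow_left₀ 2 (mul_nonneg hl0 hD0) d₂
  have g₃ : dist (γ₁.toFun s) (γ₃.toFun t) < D := by
    have := dist_triangle (γ₁.toFun s) (γ₂.toFun r) (γ₃.toFun t)
    linarith
  have g₄ : dist (γ₁.toFun s) (γ₃.toFun t) ^ 2 < D ^ 2 :=
    pow_lt_pow_left₀ g₃ dist_nonneg two_ne_zero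
  unfold comparisonCos at hst
  simp only at hst
  rw [div_lt_iff₀ (by positivity)] at hst
  rw [hD2] at g₄
  linarith

end Angle

/-- Geodesics emanating from `p` are equivalent if the angle between them is zero. -/
instance directionSetoid {M : Type*} [MetricSpace M] (p : M) : Setoid (UnitGeodesic p) where
  r γ₁ γ₂ := geodesicAngle γ₁ γ₂ = 0
  iseqv :=
    { refl := geodesicAngle_self
      symm := fun h => by rw [geodesicAngle_comm]; exact h
      trans := fun {a b c} h₁ h₂ => le_antisymm
        (by have := geodesicAngle_triangle a b c; linarith) (geodesicAngle_nonneg _ _) }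

/-- The space of directions at `p`. -/
def Direction {M : Type*} [MetricSpace M] (p : M) : Type _ := Quotient (directionSetoid p)

/-- The angle between two directions. -/
def Direction.angle {M : Type*} [MetricSpace M] {p : M} (v w : Direction p) : ℝ :=
  Quotient.liftOn₂ v w geodesicAngle (by
    intro a b a' b' (h₁ : geodesicAngle a a' = 0) (h₂ : geodesicAngle b b' = 0)
    have h₁' := geodesicAngle_comm a a'
    have h₂' := geodesicAngle_comm b b'
    have t₁ := geodesicAngle_triangle a a' b
    have t₂ := geodesicAngle_triangle a' b' b
    have t₃ := geodesicAngle_triangle a' a b'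
    have t₄ := geodesicAngle_triangle a b b'
    linarith)

/-! ### The tangent cone -/

/-- The tangent cone at `p`, that is, the product of the space of directions with `[0, ∞)` whose
slice at `0` is collapsed to one point, the apex `none`; `some (v, r)` is the vector of length
`r > 0` in direction `v`. -/
def TangentCone {M : Type*} [MetricSpace M] (p : M) : Type _ := Option (Direction p × Ioi (0 : ℝ))

namespace TangentCone

variable {M : Type*} [MetricSpace M] {p : M}

/-- The apex of the tangent cone. -/
def apex (p : M) : TangentCone p := (none : Option (Direction p × Ioi (0 : ℝ)))

/-- The vector with direction `v` and length `r`, for `r > 0`; the apex if `r ≤ 0`. -/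
def mk (v : Direction p) (r : ℝ) : TangentCone p :=
  if h : 0 < r then (some (v, ⟨r, h⟩) : Option (Direction p × Ioi (0 : ℝ))) else apex p

/-- The length of a tangent vector. -/
def length : TangentCone p → ℝ
  | none => 0
  | some (_, r) => r

/-- The angle between two tangent vectors, `π / 2` by convention if one of them is the apex. -/
def angle : TangentCone p → TangentCone p → ℝ
  | some (v, _), some (w, _) => v.angle w
  | _, _ => Real.pi / 2

/-- The inner product of two tangent vectors. -/
def inner (V W : TangentCone p) : ℝ := V.length * W.length * Real.cos (angle V W)

/-- Multiplication of a tangent vector by a nonnegative number. -/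
def scale (c : ℝ) : TangentCone p → TangentCone p
  | none => apex p
  | some (v, r) => mk v (c * r)

theorem length_nonneg (V : TangentCone p) : 0 ≤ V.length := by
  match V with
  | none => exact le_rfl
  | some (_, r) => exact le_of_lt r.2

/-- The law of cosines as the distance between two complex numbers in polar coordinates. -/
theorem polar_dist (a b θ φ : ℝ) :
    √(a ^ 2 + b ^ 2 - 2 * (a * b * Real.cos (φ - θ))) =
      dist (a * Complex.exp (θ * Complex.I)) (b * Complex.exp (φ * Complex.I)) := by
  rw [Complex.dist_eq, Complex.norm_eq_sqrt_sq_add_sq]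
  congr 1
  rw [Real.cos_sub]
  simp only [Complex.sub_re, Complex.sub_im, Complex.re_ofReal_mul, Complex.im_ofReal_mul,
    Complex.exp_ofReal_mul_I_re, Complex.exp_ofReal_mul_I_im]
  linear_combination (-a ^ 2) * (Real.sin_sq_add_cos_sq θ) + (-b ^ 2) * (Real.sin_sq_add_cos_sq φ)

theorem cone_mono {a b θ φ : ℝ} (ha : 0 ≤ a) (hb : 0 ≤ b) (hθ : 0 ≤ θ) (hφ : φ ≤ Real.pi)
    (h : θ ≤ φ) :
    √(a ^ 2 + b ^ 2 - 2 * (a * b * Real.cos θ)) ≤ √(a ^ 2 + b ^ 2 - 2 * (a * b * Real.cos φ)) := by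
  apply Real.sqrt_le_sqrt
  have := Real.cos_le_cos_of_nonneg_of_le_pi hθ hφ h
  have hab := mul_nonneg ha hb
  nlinarith

theorem cone_triangle {a b c α β γ : ℝ} (ha : 0 ≤ a) (hb : 0 ≤ b) (hc : 0 ≤ c)
    (hα' : α ≤ Real.pi) (hβ' : β ≤ Real.pi) (hγ : 0 ≤ γ) (hγ' : γ ≤ Real.pi)
    (h : γ ≤ α + β) :
    √(a ^ 2 + c ^ 2 - 2 * (a * c * Real.cos γ)) ≤
      √(a ^ 2 + b ^ 2 - 2 * (a * b * Real.cos α)) +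
        √(b ^ 2 + c ^ 2 - 2 * (b * c * Real.cos β)) := by
  rcases le_total (α + β) Real.pi with hs | hs
  · refine (cone_mono ha hc hγ hs h).trans ?_
    have e₁ := polar_dist a c 0 (α + β)
    have e₂ := polar_dist a b 0 α
    have e₃ := polar_dist b c α (α + β)
    rw [sub_zero] at e₁ e₂
    rw [add_sub_cancel_left] at e₃
    rw [e₁, e₂, e₃]
    exact dist_triangle _ _ _
  · refine (cone_mono ha hc hγ le_rfl hγ').trans ?_
    refine le_trans ?_ (add_le_add_left
      (cone_mono ha hb (θ := Real.pi - β) (φ := α) (by linarith) hα' (by linarith)) _)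
    have e₁ := polar_dist a c 0 Real.pi
    have e₂ := polar_dist a b 0 (Real.pi - β)
    have e₃ := polar_dist b c (Real.pi - β) Real.pi
    rw [sub_zero] at e₁ e₂
    rw [sub_sub_cancel] at e₃
    rw [e₁, e₂, e₃]
    exact dist_triangle _ _ _

/-- The conical metric on the tangent cone. -/
instance : MetricSpace (TangentCone p) where
  dist V W := √(V.length ^ 2 + W.length ^ 2 - 2 * inner V W)
  dist_self V := by
    match V with
    | none => simp [inner, length]
    | some (v, r) =>
      induction v using Quotient.ind with
      | _ γ =>
        have : Direction.angle (⟦γ⟧ : Direction p) ⟦γ⟧ = 0 := geodesicAngle_self γ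
        simp only [inner, length, angle]
        rw [this, Real.cos_zero]
        ring_nf
        exact Real.sqrt_zero
  dist_comm V W := by
    have : inner V W = inner W V := by
      match V, W with
      | none, none => rfl
      | none, some _ => simp [inner, length]
      | some _, none => simp [inner, length]
      | some (v, r), some (w, s) =>
        induction v using Quotient.ind with
        | _ γ =>
        induction w using Quotient.ind with
        | _ γ' =>
          have : Direction.angle (⟦γ⟧ : Direction p) ⟦γ'⟧ = Direction.angle (⟦γ'⟧ : Direction p) ⟦γ⟧ :=
            geodesicAngle_comm γ γ'
          simp only [inner, length, angle]
          rw [this]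
          ring
    rw [this, add_comm (V.length ^ 2)]
  dist_triangle U V W := by
    have hangle : ∀ v w : Direction p, 0 ≤ v.angle w ∧ v.angle w ≤ Real.pi := by
      intro v w
      induction v using Quotient.ind with
      | _ γ =>
      induction w using Quotient.ind with
      | _ γ' => exact ⟨geodesicAngle_nonneg γ γ', geodesicAngle_le_pi γ γ'⟩
    have hT : ∀ V W : TangentCone p, 0 ≤ angle V W ∧ angle V W ≤ Real.pi := by
      intro V W
      have hpi := Real.pi_pos
      match V, W with
      | none, _ => exact ⟨by simp only [angle]; linarith, by simp only [angle]; linarith⟩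
      | some _, none => exact ⟨by simp only [angle]; linarith, by simp only [angle]; linarith⟩
      | some (v, r), some (w, s) => exact hangle v w
    have hpi := Real.pi_pos
    match U, V, W with
    | none, V, W =>
      have := cone_triangle (a := 0) (α := 0) le_rfl (length_nonneg V) (length_nonneg W)
        hpi.le (hT V W).2 (hT V W).1 (hT V W).2 (by linarith)
      simpa [inner, length] using this
    | some u, none, W =>
      have := cone_triangle (b := 0) (α := Real.pi / 2) (β := Real.pi / 2)
        (length_nonneg (p := p) (some u)) le_rfl (length_nonneg W)
        (by linarith) (by linarith)
        (hT (some u) W).1 (hT (some u) W).2 (by have := (hT (some u) W).2; linarith)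
      simpa [inner, length] using this
    | some u, some v, none =>
      have := cone_triangle (c := 0) (β := 0)
        (length_nonneg (p := p) (some u)) (length_nonneg (p := p) (some v)) le_rfl
        (hT (some u) (some v)).2 hpi.le
        (hT (some u) (some v)).1 (hT (some u) (some v)).2 (by linarith)
      simpa [inner, length] using this
    | some (u, a), some (v, b), some (w, c) =>
      have key : u.angle w ≤ u.angle v + v.angle w := by
        induction u using Quotient.ind with
        | _ γ₁ =>
        induction v using Quotient.ind with
        | _ γ₂ =>
        induction w using Quotient.ind with
        | _ γ₃ => exact geodesicAngle_triangle γ₁ γ₂ γ₃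
      exact cone_triangle (le_of_lt a.2) (le_of_lt b.2) (le_of_lt c.2)
        (hangle u v).2 (hangle v w).2 (hangle u w).1 (hangle u w).2 key
  eq_of_dist_eq_zero {V W} h := by
    have hpos : ∀ a b c : ℝ, 0 ≤ a → 0 ≤ b → c ≤ 1 →
        √(a ^ 2 + b ^ 2 - 2 * (a * b * c)) = 0 → a = b ∧ a * b * (1 - c) = 0 := by
      intro a b c ha hb hc h
      have hab : 0 ≤ a * b * (1 - c) := mul_nonneg (mul_nonneg ha hb) (by linarith)
      rw [Real.sqrt_eq_zero'] at h
      have hsq : (a - b) ^ 2 = 0 := by nlinarith [sq_nonneg (a - b)]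
      exact ⟨by nlinarith [pow_eq_zero_iff (two_ne_zero) |>.1 hsq], by nlinarith⟩
    obtain ⟨h₁, h₂⟩ := hpos _ _ _ (length_nonneg V) (length_nonneg W) (Real.cos_le_one _) h
    match V, W with
    | none, none => rfl
    | none, some (w, s) => exact absurd h₁ (ne_of_lt s.2)
    | some (v, r), none => exact absurd h₁ (ne_of_gt r.2)
    | some (v, r), some (w, s) =>
      have hrs : r = s := Subtype.ext h₁
      have hr : (0 : ℝ) < r := r.2
      have hs : (0 : ℝ) < s := s.2
      induction v using Quotient.ind with
      | _ γ =>
      induction w using Quotient.ind with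
      | _ γ' =>
        have hcos : Real.cos (geodesicAngle γ γ') = 1 := by
          have h₃ : (r : ℝ) * s * (1 - Real.cos (geodesicAngle γ γ')) = 0 := h₂
          have : (r : ℝ) * s ≠ 0 := by positivity
          have := (mul_eq_zero.1 h₃).resolve_left this
          linarith
        have h0 : geodesicAngle γ γ' = 0 := by
          rw [← Real.arccos_cos (geodesicAngle_nonneg γ γ') (geodesicAngle_le_pi γ γ'), hcos,
            Real.arccos_one]
        have : (⟦γ⟧ : Quotient (directionSetoid p)) = ⟦γ'⟧ := Quotient.sound h0
        rw [this, hrs]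

instance : MeasurableSpace (TangentCone p) := borel _

instance : BorelSpace (TangentCone p) := ⟨rfl⟩

/-- `K` is a geodesically convex cone: it is closed under multiplication by nonnegative numbers,
and contains all shortest paths between its points. -/
structure IsConvexCone (K : Set (TangentCone p)) : Prop where
  scale_mem : ∀ c : ℝ, 0 ≤ c → ∀ V ∈ K, scale c V ∈ K
  convex : ∀ V ∈ K, ∀ W ∈ K, ∀ γ : ℝ → TangentCone p, IsShortestPath γ V W →
    ∀ t ∈ Icc 0 (dist V W), γ t ∈ K

/-- The hull of `S`: the smallest geodesically convex cone that contains `S`. -/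
def hull (S : Set (TangentCone p)) : Set (TangentCone p) :=
  ⋂₀ {K | IsConvexCone K ∧ S ⊆ K}

end TangentCone

/-- A shortest path from `p` to a different point, as a geodesic emanating from `p`. -/
def IsShortestPath.toUnitGeodesic {M : Type*} [MetricSpace M] {γ : ℝ → M} {p x : M}
    (h : IsShortestPath γ p x) (hx : p ≠ x) : UnitGeodesic p where
  toFun := γ
  source := h.source
  isom := ⟨dist p x, dist_pos.2 hx, fun s hs t ht => h.isom s ⟨hs.1, hs.2.le⟩ t ⟨ht.1, ht.2.le⟩⟩

open Classical in
/-- The logarithm map at `p`: a point `x` with a unique shortest path from `p` is sent to the vector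
of length `dist p x` in the direction of that path (the apex for `x = p`). The value at other points
is meaningless. -/
def logMap {M : Type*} [MetricSpace M] (p x : M) : TangentCone p :=
  if h : p ≠ x ∧ ∃ γ : ℝ → M, IsShortestPath γ p x then
    TangentCone.mk (⟦(Classical.choose_spec h.2).toUnitGeodesic h.1⟧ : Quotient (directionSetoid p))
      (dist p x)
  else TangentCone.apex p

/-! ### Localized measures, escape cone and fluctuating cone -/

section Measure

variable {M : Type*} [MetricSpace M] [MeasurableSpace M]

/-- The Fréchet function of `μ`. -/
def frechet (μ : Measure M) (q : M) : ℝ := (1 / 2) * ∫ x, dist q x ^ 2 ∂μ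

/-- `b` is a Fréchet mean of `μ`: the Fréchet function is finite and attains its minimum at `b`. -/
def IsFrechetMean (μ : Measure M) (b : M) : Prop :=
  (∀ q, Integrable (fun x => dist q x ^ 2) μ) ∧ ∀ q, frechet μ b ≤ frechet μ q

/-- `f` is convex near `b`: it is convex along all shortest paths in some ball around `b`. -/
def ConvexNear (f : M → ℝ) (b : M) : Prop :=
  ∃ r > 0, ∀ x y : M, ∀ γ : ℝ → M, IsShortestPath γ x y →
    (∀ t ∈ Icc 0 (dist x y), γ t ∈ Metric.ball b r) →
    ConvexOn ℝ (Icc 0 (dist x y)) (fun t => f (γ t))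

/-- `μ` is punctual: it has exactly one Fréchet mean, and its Fréchet function is convex near it. -/
def IsPunctual (μ : Measure M) : Prop :=
  ∃ b, IsFrechetMean μ b ∧ (∀ b', IsFrechetMean μ b' → b' = b) ∧ ConvexNear (frechet μ) b

/-- `μ` is retractable: almost every point has a unique shortest path to the Fréchet mean. -/
def IsRetractable (μ : Measure M) : Prop :=
  ∀ b, IsFrechetMean μ b → ∀ᵐ x ∂μ, HasUniqueShortestPath b x

/-- `μ` is localized if it is punctual and retractable. -/
def IsLocalized (μ : Measure M) : Prop := IsPunctual μ ∧ IsRetractable μ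

/-- `f` has the directional derivative `c` at `p` along `V`: the right derivative at `0` of
`t ↦ f (exp (t V))` is `c`, where `exp (t V) = γ (t * r)` if `V` has length `r > 0` and its
direction is represented by the geodesic `γ`, and `exp (t V) = p` if `V` is the apex. -/
def HasDirDeriv {p : M} (f : M → ℝ) (V : TangentCone p) (c : ℝ) : Prop :=
  match V with
  | none => c = 0
  | some (v, r) => ∃ γ : UnitGeodesic p, (⟦γ⟧ : Quotient (directionSetoid p)) = v ∧
      HasDerivWithinAt (fun t : ℝ => f (γ.toFun (t * r))) c (Ici 0) 0

/-- The escape cone: the directions at `b` along which the directional derivative of the Fréchet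
function of `μ` vanishes. -/
def escapeCone (μ : Measure M) (b : M) : Set (TangentCone b) := {V | HasDirDeriv (frechet μ) V 0}

/-- The hull of `μ`: the hull of the support of the pushforward of `μ` under the logarithm map. -/
def hullMeasure (μ : Measure M) (b : M) : Set (TangentCone b) :=
  TangentCone.hull (μ.map (logMap b)).support

/-- The fluctuating cone of `μ`, a measure with Fréchet mean `b`. -/
def fluctuatingCone (μ : Measure M) (b : M) : Set (TangentCone b) :=
  escapeCone μ b ∩ hullMeasure μ b

end Measure

end FrechetGeometry

end

/-!
The proof compares two opposite escape directions with the measure and transfers the outcome to the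
hull by convexity. Let `⟨V, W⟩` denote the inner product `TangentCone.inner` on the tangent cone
at `b`.

*First variation.* Along a geodesic `γ` from `b`, the distance to a point `x` decreases at most at
the rate given by the cosine of the angle at `b` between `γ` and the shortest path to `x`
(`HasSphericalComparison.eventually_le_dist_sub_div`). This is local near `b`, once shortest paths
from `γ t` to `x` are known to leave along that shortest path; they do so by comparison if `x` is
not too far away (`first_variation_of_dist_lt`), and by compactness and uniqueness otherwise
(`first_variation_of_unique`). So the derivative of the Fréchet function along a unit vector `Z`
is at least `-∫ ⟨log x, Z⟩ dμ`.

*Opposite directions.* If the unit vectors `Z` and `X` make an angle `π`, then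
`⟨W, Z⟩ + ⟨W, X⟩ ≤ 0` for every `W`, by the triangle inequality for angles. If moreover `Z` and `X`
are escape vectors, the first variation bound makes the integral of this nonpositive function
nonnegative, so it vanishes at `W = log x` for almost every `x` (`ae_inner_add_inner_eq_zero`). The
integral itself is never formed, since measurability of the logarithm is not available: dominated
convergence for the negative parts of the difference quotients shows that these tend to zero in
`L¹`, so a subsequence tends to zero almost everywhere.

*Convexity.* The tangent cone inherits the `CAT(0)` inequality by blowing up `M` at `b`
(`TangentCone.stewart`), although it need not be a geodesic space. Therefore `W ↦ ⟨W, U⟩`, which is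
minus a Busemann function, is concave along shortest paths (`TangentCone.inner_concave`), and
`{W | ⟨W, Z⟩ + ⟨W, X⟩ = 0}` is a closed convex cone. It contains the support, hence the hull of `μ`.
A second vector `X'` as in the theorem lies in the hull, so `⟨X', X⟩ = -⟨X', Z⟩ = 1` and `X' = X`.

*Comparison.* All values of `κ` are treated at once: a `CAT(κ)` space is compared with a sphere, in
the form of Stewart's inequality for the distance from a vertex of a triangle to a point of the
opposite side (`HasSphericalComparison`). For `κ ≤ 0` this follows from the hyperbolic or Euclidean
case since `w ↦ cosh √w` and `w ↦ cos √w` are convex.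
-/

namespace FrechetGeometry

/-! ### Stewart's theorem in the model planes -/

theorem convexOn_cosh_sqrt : ConvexOn ℝ (Ici 0) fun w : ℝ => Real.cosh √w := by
  have hd : ∀ w ∈ Ioi (0 : ℝ),
      HasDerivAt (fun w : ℝ => Real.cosh √w) (Real.sinh √w * (1 / (2 * √w))) w := fun w hw =>
    (Real.hasDerivAt_cosh _).comp w (Real.hasDerivAt_sqrt (ne_of_gt hw))
  have hsinh : ConvexOn ℝ (Ici 0) Real.sinh := by
    refine MonotoneOn.convexOn_of_deriv (convex_Ici 0) Real.continuous_sinh.continuousOn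
      Real.differentiable_sinh.differentiableOn fun u hu v hv huv => ?_
    rw [interior_Ici, mem_Ioi] at hu hv
    rw [Real.deriv_sinh, Real.cosh_le_cosh, abs_of_pos hu, abs_of_pos hv]
    exact huv
  refine MonotoneOn.convexOn_of_deriv (convex_Ici 0) (by fun_prop) ?_ ?_
  · rw [interior_Ici]
    exact fun w hw => (hd w hw).differentiableAt.differentiableWithinAt
  · rw [interior_Ici]
    intro v hv w hw hvw
    rw [(hd v hv).deriv, (hd w hw).deriv]
    have h := hsinh.secant_mono (a := 0) (x := √v) (y := √w) self_mem_Ici (Real.sqrt_nonneg _)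
      (Real.sqrt_nonneg _) (Real.sqrt_pos.2 hv).ne' (Real.sqrt_pos.2 hw).ne' (Real.sqrt_le_sqrt hvw)
    simp only [Real.sinh_zero, sub_zero] at h
    calc Real.sinh √v * (1 / (2 * √v)) = Real.sinh √v / √v / 2 := by field_simp
      _ ≤ Real.sinh √w / √w / 2 := by gcongr
      _ = Real.sinh √w * (1 / (2 * √w)) := by field_simp

theorem convexOn_cos_sqrt : ConvexOn ℝ (Icc 0 (Real.pi ^ 2)) fun w : ℝ => Real.cos √w := by
  have hd : ∀ w ∈ Ioo (0 : ℝ) (Real.pi ^ 2),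
      HasDerivAt (fun w : ℝ => Real.cos √w) (-Real.sin √w * (1 / (2 * √w))) w := fun w hw =>
    (Real.hasDerivAt_cos _).comp w (Real.hasDerivAt_sqrt (ne_of_gt hw.1))
  have hm : ∀ w ∈ Ioo (0 : ℝ) (Real.pi ^ 2), √w ∈ Icc 0 Real.pi := fun w hw =>
    ⟨Real.sqrt_nonneg _, (Real.sqrt_le_left Real.pi_pos.le).2 hw.2.le⟩
  refine MonotoneOn.convexOn_of_deriv (convex_Icc 0 _) (by fun_prop) ?_ ?_
  · rw [interior_Icc]
    exact fun w hw => (hd w hw).differentiableAt.differentiableWithinAt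
  · rw [interior_Icc]
    intro v hv w hw hvw
    rw [(hd v hv).deriv, (hd w hw).deriv]
    have h := strictConcaveOn_sin_Icc.concaveOn.neg.secant_mono (a := 0) (x := √v) (y := √w)
      ⟨le_rfl, Real.pi_pos.le⟩ (hm v hv) (hm w hw) (Real.sqrt_pos.2 hv.1).ne'
      (Real.sqrt_pos.2 hw.1).ne' (Real.sqrt_le_sqrt hvw)
    simp only [Pi.neg_apply, Real.sin_zero, neg_zero, sub_zero] at h
    calc -Real.sin √v * (1 / (2 * √v)) = -Real.sin √v / √v / 2 := by field_simp
      _ ≤ -Real.sin √w / √w / 2 := by gcongr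
      _ = -Real.sin √w * (1 / (2 * √w)) := by field_simp

/-- The side opposite to an angle with cosine `c` is at least as long in the hyperbolic plane as in
the Euclidean plane. -/
theorem cosh_sqrt_le {a b c : ℝ} (hc : c ∈ Icc (-1) 1) :
    Real.cosh √(a ^ 2 + b ^ 2 - 2 * a * b * c) ≤
      Real.cosh a * Real.cosh b - Real.sinh a * Real.sinh b * c := by
  have h := convexOn_cosh_sqrt.2 (show (a - b) ^ 2 ∈ Ici 0 from sq_nonneg (a - b))
    (show (a + b) ^ 2 ∈ Ici 0 from sq_nonneg (a + b))
    (show 0 ≤ (1 + c) / 2 by linarith [hc.1]) (show 0 ≤ (1 - c) / 2 by linarith [hc.2]) (by ring)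
  simp only [smul_eq_mul, Real.sqrt_sq_eq_abs, Real.cosh_abs] at h
  rw [Real.cosh_sub, Real.cosh_add] at h
  rw [show a ^ 2 + b ^ 2 - 2 * a * b * c =
    (1 + c) / 2 * (a - b) ^ 2 + (1 - c) / 2 * (a + b) ^ 2 by ring]
  linarith

/-- The side opposite to an angle with cosine `c` is at most as long on the unit sphere as in the
Euclidean plane. -/
theorem cos_sqrt_le {a b c : ℝ} (ha : 0 ≤ a) (hb : 0 ≤ b) (hab : a + b ≤ Real.pi)
    (hc : c ∈ Icc (-1) 1) :
    Real.cos √(a ^ 2 + b ^ 2 - 2 * a * b * c) ≤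
      Real.cos a * Real.cos b + Real.sin a * Real.sin b * c := by
  have h := convexOn_cos_sqrt.2
    (show (a - b) ^ 2 ∈ Icc 0 (Real.pi ^ 2) from
      ⟨sq_nonneg _, by apply sq_le_sq' <;> linarith⟩)
    (show (a + b) ^ 2 ∈ Icc 0 (Real.pi ^ 2) from
      ⟨sq_nonneg _, by apply sq_le_sq' <;> linarith⟩)
    (show 0 ≤ (1 + c) / 2 by linarith [hc.1]) (show 0 ≤ (1 - c) / 2 by linarith [hc.2]) (by ring)
  simp only [smul_eq_mul, Real.sqrt_sq_eq_abs, Real.cos_abs] at h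
  rw [Real.cos_sub, Real.cos_add] at h
  rw [show a ^ 2 + b ^ 2 - 2 * a * b * c =
    (1 + c) / 2 * (a - b) ^ 2 + (1 - c) / 2 * (a + b) ^ 2 by ring]
  linarith

/-- A hyperbolic triangle with a cevian of length `h` that cuts the opposite side into `a` and `b`
satisfies the Euclidean Stewart inequality: with the angle at the foot of the cevian held fixed, the
two other sides only become shorter in the Euclidean plane. -/
theorem euclidean_stewart_of_hyperbolic {a b h u v : ℝ} (ha : 0 ≤ a) (hb : 0 ≤ b) (hh : 0 ≤ h)
    (hu : 0 ≤ u) (hv : 0 ≤ v) (h₁ : h ≤ u + a) (h₂ : a ≤ h + u) (h₃ : u ≤ h + a) (h₄ : b ≤ h + v)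
    (H : Real.cosh h * Real.sinh (a + b) ≤
      Real.sinh b * Real.cosh u + Real.sinh a * Real.cosh v) :
    (a + b) * (h ^ 2 + a * b) ≤ b * u ^ 2 + a * v ^ 2 := by
  rcases ha.eq_or_lt with rfl | ha'
  · have : h = u := by linarith
    subst this; nlinarith
  rcases hh.eq_or_lt with rfl | hh'
  · have e₁ : a ^ 2 ≤ u ^ 2 := by apply pow_le_pow_left₀ ha; linarith
    have e₂ : b ^ 2 ≤ v ^ 2 := by apply pow_le_pow_left₀ hb; linarith
    nlinarith
  have sa := Real.sinh_pos_iff.2 ha'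
  have sb := Real.sinh_nonneg_iff.2 hb
  have sh := Real.sinh_pos_iff.2 hh'
  obtain ⟨c, hc⟩ : ∃ c, c = (Real.cosh h * Real.cosh a - Real.cosh u) /
    (Real.sinh h * Real.sinh a) := ⟨_, rfl⟩
  have hcu : Real.cosh u = Real.cosh h * Real.cosh a - Real.sinh h * Real.sinh a * c := by
    rw [hc]; field_simp; ring
  have hc1 : c ≤ 1 := by
    rw [hc, div_le_one (by positivity)]
    have : Real.cosh (h - a) ≤ Real.cosh u := by
      rw [Real.cosh_le_cosh, abs_of_nonneg hu, abs_le]; constructor <;> linarith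
    rw [Real.cosh_sub] at this; linarith
  have hc2 : -1 ≤ c := by
    rw [hc, le_div_iff₀ (by positivity)]
    have : Real.cosh u ≤ Real.cosh (h + a) := by
      rw [Real.cosh_le_cosh, abs_of_nonneg hu, abs_of_nonneg (by linarith)]; linarith
    rw [Real.cosh_add] at this; linarith
  have hcv : Real.cosh h * Real.cosh b - Real.sinh h * Real.sinh b * (-c) ≤ Real.cosh v := by
    rw [Real.sinh_add, hcu] at H
    refine le_of_mul_le_mul_left ?_ sa
    linarith
  have e₁ := cosh_sqrt_le (a := h) (b := a) (c := c) ⟨hc2, hc1⟩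
  have e₂ := cosh_sqrt_le (a := h) (b := b) (c := -c) ⟨by linarith, by linarith⟩
  rw [← hcu, Real.cosh_le_cosh, abs_of_nonneg (Real.sqrt_nonneg _), abs_of_nonneg hu] at e₁
  replace e₂ := e₂.trans hcv
  rw [Real.cosh_le_cosh, abs_of_nonneg (Real.sqrt_nonneg _), abs_of_nonneg hv] at e₂
  rw [Real.sqrt_le_left hu] at e₁
  rw [Real.sqrt_le_left hv] at e₂
  nlinarith [mul_le_mul_of_nonneg_left e₁ hb, mul_le_mul_of_nonneg_left e₂ ha]

/-- The Euclidean Stewart inequality implies the spherical one for small triangles: with the angle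
at the foot of the cevian held fixed, the two other sides only become shorter on the sphere. -/
theorem spherical_stewart_of_euclidean {a b h u v : ℝ} (ha : 0 ≤ a) (hb : 0 ≤ b) (hh : 0 ≤ h)
    (hu : 0 ≤ u) (hv : 0 ≤ v) (h₁ : h ≤ u + a) (h₂ : a ≤ h + u) (h₃ : u ≤ h + a) (h₄ : b ≤ h + v)
    (hau : u ≤ Real.pi) (hav : v ≤ Real.pi) (hha : h + a ≤ Real.pi) (hhb : h + b ≤ Real.pi)
    (H : (a + b) * (h ^ 2 + a * b) ≤ b * u ^ 2 + a * v ^ 2) :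
    Real.sin b * Real.cos u + Real.sin a * Real.cos v ≤ Real.sin (a + b) * Real.cos h := by
  have sa := Real.sin_nonneg_of_nonneg_of_le_pi ha (by linarith)
  have sb := Real.sin_nonneg_of_nonneg_of_le_pi hb (by linarith)
  rcases ha.eq_or_lt with rfl | ha'
  · have : h = u := by linarith
    subst this; simp
  rcases hh.eq_or_lt with rfl | hh'
  · have e₁ := Real.cos_le_cos_of_nonneg_of_le_pi ha hau (by linarith)
    have e₂ := Real.cos_le_cos_of_nonneg_of_le_pi hb hav (by linarith)
    rw [Real.sin_add, Real.cos_zero]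
    nlinarith [mul_le_mul_of_nonneg_left e₁ sb, mul_le_mul_of_nonneg_left e₂ sa]
  obtain ⟨c, hc⟩ : ∃ c, c = (h ^ 2 + a ^ 2 - u ^ 2) / (2 * h * a) := ⟨_, rfl⟩
  have hcu : u ^ 2 = h ^ 2 + a ^ 2 - 2 * h * a * c := by rw [hc]; field_simp; ring
  have hc1 : c ≤ 1 := by
    rw [hc, div_le_one (by positivity)]
    have : (h - a) ^ 2 ≤ u ^ 2 := by apply sq_le_sq' <;> linarith
    linarith
  have hc2 : -1 ≤ c := by
    rw [hc, le_div_iff₀ (by positivity)]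
    have : u ^ 2 ≤ (h + a) ^ 2 := by apply pow_le_pow_left₀ hu; linarith
    linarith
  have hcv : h ^ 2 + b ^ 2 - 2 * h * b * (-c) ≤ v ^ 2 := by
    refine le_of_mul_le_mul_left ?_ ha'
    rw [hcu] at H
    linarith
  have e₁ := cos_sqrt_le (a := h) (b := a) (c := c) hh ha hha ⟨hc2, hc1⟩
  have e₂ := cos_sqrt_le (a := h) (b := b) (c := -c) hh hb hhb ⟨by linarith, by linarith⟩
  rw [← hcu, Real.sqrt_sq hu] at e₁
  have e₃ : Real.cos v ≤ Real.cos √(h ^ 2 + b ^ 2 - 2 * h * b * (-c)) :=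
    Real.cos_le_cos_of_nonneg_of_le_pi (Real.sqrt_nonneg _) hav ((Real.sqrt_le_left hv).2 hcv)
  rw [Real.sin_add]
  nlinarith [mul_le_mul_of_nonneg_left e₁ sb, mul_le_mul_of_nonneg_left (e₃.trans e₂) sa]

/-- Stewart's theorem in the hyperbolic plane. -/
theorem hyperbolic_stewart (x y z p : UpperHalfPlane) (h : dist x p + dist p y = dist x y) :
    Real.cosh (dist z p) * Real.sinh (dist x y) =
      Real.sinh (dist p y) * Real.cosh (dist z x) + Real.sinh (dist x p) * Real.cosh (dist z y) := by
  -- In the hyperboloid model with coordinates `A = (re² + im²) / im`, `B = 1 / im`, `C = re / im`,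
  -- `cosh dist` is a Lorentzian bilinear form. The vector
  -- `sinh (dist x y) • p - sinh (dist p y) • x - sinh (dist x p) • y` is null and orthogonal to the
  -- timelike vector `p`, so it vanishes.
  have key : ∀ u v : UpperHalfPlane, Real.cosh (dist u v) =
      ((u.re ^ 2 + u.im ^ 2) / u.im * (1 / v.im) + (v.re ^ 2 + v.im ^ 2) / v.im * (1 / u.im)) / 2
        - u.re / u.im * (v.re / v.im) := by
    intro u v
    have := u.im_pos
    have := v.im_pos
    rw [UpperHalfPlane.cosh_dist']
    field_simp
    ring
  have one : ∀ u : UpperHalfPlane,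
      (u.re ^ 2 + u.im ^ 2) / u.im * (1 / u.im) - (u.re / u.im) ^ 2 = 1 := by
    intro u
    have := u.im_pos
    field_simp
    ring
  have k₁ := key x p
  have k₂ := key p y
  have k₃ := key x y
  have k₄ := key z x
  have k₅ := key z y
  have k₆ := key z p
  have o₁ := one x
  have o₂ := one y
  have o₃ := one p
  have sx : Real.sinh (dist x p) ^ 2 = Real.cosh (dist x p) ^ 2 - 1 := by rw [Real.sinh_sq]
  have sy : Real.sinh (dist p y) ^ 2 = Real.cosh (dist p y) ^ 2 - 1 := by rw [Real.sinh_sq]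
  rw [← h, Real.cosh_add] at k₃
  rw [← h, Real.sinh_add, k₄, k₅, k₆]
  clear k₄ k₅ k₆ key one h
  generalize (x.re ^ 2 + x.im ^ 2) / x.im = A₁ at *
  generalize (y.re ^ 2 + y.im ^ 2) / y.im = A₂ at *
  generalize (p.re ^ 2 + p.im ^ 2) / p.im = A₃ at *
  generalize (z.re ^ 2 + z.im ^ 2) / z.im = A₄ at *
  generalize 1 / x.im = B₁ at *
  generalize 1 / y.im = B₂ at *
  generalize 1 / p.im = B₃ at *
  generalize 1 / z.im = B₄ at *
  generalize x.re / x.im = C₁ at *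
  generalize y.re / y.im = C₂ at *
  generalize p.re / p.im = C₃ at *
  generalize z.re / z.im = C₄ at *
  generalize Real.sinh (dist x p) = s at *
  generalize Real.sinh (dist p y) = t at *
  generalize Real.cosh (dist x p) = c at *
  generalize Real.cosh (dist p y) = d at *
  obtain ⟨D, hD⟩ : ∃ D, D = s * d + c * t := ⟨_, rfl⟩
  rw [← hD]
  obtain ⟨A, hA⟩ : ∃ A, A = D * A₃ - t * A₁ - s * A₂ := ⟨_, rfl⟩
  obtain ⟨B, hB⟩ : ∃ B, B = D * B₃ - t * B₁ - s * B₂ := ⟨_, rfl⟩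
  obtain ⟨C, hC⟩ : ∃ C, C = D * C₃ - t * C₁ - s * C₂ := ⟨_, rfl⟩
  have null : A * B - C ^ 2 = 0 := by
    have : A * B - C ^ 2 = D ^ 2 * (A₃ * B₃ - C₃ ^ 2) + t ^ 2 * (A₁ * B₁ - C₁ ^ 2)
        + s ^ 2 * (A₂ * B₂ - C₂ ^ 2) - 2 * D * t * ((A₁ * B₃ + A₃ * B₁) / 2 - C₁ * C₃)
        - 2 * D * s * ((A₃ * B₂ + A₂ * B₃) / 2 - C₃ * C₂)
        + 2 * s * t * ((A₁ * B₂ + A₂ * B₁) / 2 - C₁ * C₂) := by rw [hA, hB, hC]; ring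
    rw [this, o₁, o₂, o₃, ← k₁, ← k₂, ← k₃, hD]
    linear_combination (t ^ 2) * sx + (s ^ 2) * sy
  have orth : (A * B₃ + A₃ * B) / 2 - C * C₃ = 0 := by
    have : (A * B₃ + A₃ * B) / 2 - C * C₃ = D * (A₃ * B₃ - C₃ ^ 2)
        - t * ((A₁ * B₃ + A₃ * B₁) / 2 - C₁ * C₃)
        - s * ((A₃ * B₂ + A₂ * B₃) / 2 - C₃ * C₂) := by rw [hA, hB, hC]; ring
    rw [this, o₃, ← k₁, ← k₂, hD]
    ring
  have hsq : (A * B₃ - A₃ * B) ^ 2 + 4 * C ^ 2 = 0 := by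
    linear_combination (4 * (A * B₃ + A₃ * B) / 2 + 4 * C * C₃) * orth
      + (-4 * A₃ * B₃) * null - 4 * C ^ 2 * o₃
  have hC0 : C = 0 := by nlinarith [sq_nonneg (A * B₃ - A₃ * B), sq_nonneg C]
  have hAB : A * B₃ - A₃ * B = 0 := by
    nlinarith [sq_nonneg (A * B₃ - A₃ * B), sq_nonneg C]
  rw [hC0] at orth
  have hAB3 : A₃ * B₃ ≠ 0 := by nlinarith [sq_nonneg C₃]
  have hA0 : A = 0 := by
    have : A * B₃ = 0 := by linarith
    exact (mul_eq_zero.1 this).resolve_right (right_ne_zero_of_mul hAB3)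
  have hB0 : B = 0 := by
    have : A₃ * B = 0 := by linarith
    exact (mul_eq_zero.1 this).resolve_left (left_ne_zero_of_mul hAB3)
  rw [hA0] at hA
  rw [hB0] at hB
  rw [hC0] at hC
  linear_combination (-B₄ / 2) * hA + (-A₄ / 2) * hB + C₄ * hC

/-- Stewart's theorem on the unit sphere. -/
theorem spherical_stewart {E : Type*} [NormedAddCommGroup E] [InnerProductSpace ℝ E] {x y z p : E}
    (hx : ‖x‖ = 1) (hy : ‖y‖ = 1) (hz : ‖z‖ = 1) (hp : ‖p‖ = 1)
    (h : InnerProductGeometry.angle x p + InnerProductGeometry.angle p y =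
      InnerProductGeometry.angle x y) :
    Real.sin (InnerProductGeometry.angle p y) * Real.cos (InnerProductGeometry.angle z x) +
        Real.sin (InnerProductGeometry.angle x p) * Real.cos (InnerProductGeometry.angle z y) =
      Real.sin (InnerProductGeometry.angle x y) * Real.cos (InnerProductGeometry.angle z p) := by
  have key : ∀ u v : E, ‖u‖ = 1 → ‖v‖ = 1 →
      Real.cos (InnerProductGeometry.angle u v) = inner ℝ u v := by
    intro u v hu hv
    rw [InnerProductGeometry.cos_angle, hu, hv]; simp
  have k₁ := key x p hx hp
  have k₂ := key p y hp hy
  have k₃ := key x y hx hy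
  rw [← h, Real.cos_add] at k₃
  rw [key z x hz hx, key z y hz hy, key z p hz hp, ← h, Real.sin_add]
  have sx := Real.sin_sq_add_cos_sq (InnerProductGeometry.angle x p)
  have sy := Real.sin_sq_add_cos_sq (InnerProductGeometry.angle p y)
  generalize Real.sin (InnerProductGeometry.angle x p) = s at *
  generalize Real.sin (InnerProductGeometry.angle p y) = t at *
  generalize Real.cos (InnerProductGeometry.angle x p) = c at *
  generalize Real.cos (InnerProductGeometry.angle p y) = d at *
  obtain ⟨D, hD⟩ : ∃ D, D = s * d + c * t := ⟨_, rfl⟩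
  rw [← hD]
  have k₁' : inner ℝ p x = c := by rw [real_inner_comm, k₁]
  have k₂' : inner ℝ y p = d := by rw [real_inner_comm, k₂]
  have k₃' : inner ℝ y x = c * d - s * t := by rw [real_inner_comm, k₃]
  have hw : D • p - t • x - s • y = 0 := by
    rw [← inner_self_eq_zero (𝕜 := ℝ)]
    simp only [inner_sub_left, inner_sub_right, real_inner_smul_left, real_inner_smul_right]
    simp only [real_inner_self_eq_norm_sq, hx, hy, hp, k₁', k₂', k₃', ← k₁, ← k₂, ← k₃]
    rw [hD]
    linear_combination (-t ^ 2) * sx + (-s ^ 2) * sy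
  have := congrArg (fun w => inner ℝ z w) hw
  simp only [inner_sub_right, real_inner_smul_right, inner_zero_right] at this
  linarith

/-- Stewart's theorem in an inner product space. -/
theorem euclidean_stewart {E : Type*} [NormedAddCommGroup E] [InnerProductSpace ℝ E] (x y z p : E)
    (h : dist x p + dist p y = dist x y) :
    dist x y * (dist z p ^ 2 + dist x p * dist p y) =
      dist p y * dist z x ^ 2 + dist x p * dist z y ^ 2 := by
  obtain ⟨l, ⟨hl0, hl1⟩, rfl⟩ := dist_add_dist_eq_iff.1 h
  rw [dist_lineMap_right, dist_left_lineMap, Real.norm_of_nonneg hl0,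
    Real.norm_of_nonneg (by linarith)]
  have : dist z (AffineMap.lineMap x y l) ^ 2 =
      (1 - l) * dist z x ^ 2 + l * dist z y ^ 2 - l * (1 - l) * dist x y ^ 2 := by
    have e₁ : z - AffineMap.lineMap x y l = (1 - l) • (z - x) + l • (z - y) := by
      rw [AffineMap.lineMap_apply_module]; module
    have e₂ : x - y = (z - y) - (z - x) := by abel
    simp only [dist_eq_norm]
    have e₃ := norm_sub_sq_real (z - y) (z - x)
    rw [e₁, e₂, norm_add_sq_real, norm_smul, norm_smul,
      Real.norm_of_nonneg hl0, Real.norm_of_nonneg (by linarith : 0 ≤ 1 - l),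
      real_inner_smul_left, real_inner_smul_right, real_inner_comm]
    linear_combination l * (1 - l) * e₃
  rw [this]
  ring

/-! ### Comparison with a sphere -/

/-- Triangles in `M` of perimeter less than `R` are at least as thin as on the sphere of curvature
`k ^ 2`, and points at distance less than `R / 2` are joined by a shortest path. Thinness is
expressed by Stewart's inequality for the distance from a vertex `z` to a point `p` of the opposite
side `x y`. -/
structure HasSphericalComparison (k R : ℝ) (M : Type*) [MetricSpace M] : Prop where
  pos : 0 < k
  radius_pos : 0 < R
  mul_le : k * R ≤ 2 * Real.pi
  exists_shortestPath : ∀ x y : M, dist x y < R / 2 → ∃ γ : ℝ → M, IsShortestPath γ x y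
  stewart : ∀ x y z p : M, dist x y + dist y z + dist x z < R →
    dist x p + dist p y = dist x y →
    Real.sin (k * dist p y) * Real.cos (k * dist z x) +
      Real.sin (k * dist x p) * Real.cos (k * dist z y) ≤
        Real.sin (k * dist x y) * Real.cos (k * dist z p)

variable {M : Type*} [MetricSpace M]

/-- Triangles in a `CAT(κ)` space with `κ ≤ 0` are at least as thin as in the Euclidean plane. -/
theorem IsCAT.euclidean_stewart {κ : ℝ} (hM : IsCAT κ M) (hκ : κ ≤ 0) {x y z p : M}
    (h : dist x p + dist p y = dist x y) :
    dist x y * (dist z p ^ 2 + dist x p * dist p y) ≤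
      dist p y * dist z x ^ 2 + dist x p * dist z y ^ 2 := by
  obtain ⟨h₁, h₂, -⟩ := hM.comparison x y z p z (fun h => absurd hκ (not_le.2 h)) h (by simp)
  rcases hκ.lt_or_eq with hneg | rfl
  · obtain ⟨x', y', z', p', q', e₁, e₂, e₃, e₄, e₅, e₆, e₇, e₈⟩ := h₁ hneg
    obtain ⟨q, hq⟩ : ∃ q, q = √(-κ) := ⟨_, rfl⟩
    have hq0 : 0 < q := hq ▸ Real.sqrt_pos.2 (by linarith)
    simp only [← hq] at e₁ e₂ e₃ e₄ e₅ e₆ e₇ e₈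
    rw [dist_self, div_eq_zero_iff, or_iff_left hq0.ne', dist_eq_zero] at e₇
    subst e₇
    rw [div_eq_iff hq0.ne'] at e₁ e₂ e₃ e₄ e₅
    rw [le_div_iff₀ hq0] at e₈
    have hs := hyperbolic_stewart x' y' q' p' (by rw [e₁, e₄, e₅, ← h]; ring)
    rw [dist_comm q' x', dist_comm q' y', e₁, e₂, e₃, e₄, e₅, dist_comm q' p'] at hs
    have hc : Real.cosh (dist z p * q) ≤ Real.cosh (dist p' q') := by
      rw [Real.cosh_le_cosh, abs_of_nonneg (by positivity), abs_of_nonneg dist_nonneg, dist_comm z]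
      exact e₈
    have t₁ := dist_triangle z x p
    have t₂ := dist_triangle_left x p z
    have t₃ := dist_triangle z p x
    have t₄ := dist_triangle_left p y z
    have hsinh : 0 ≤ Real.sinh (dist x y * q) := Real.sinh_nonneg_iff.2 (by positivity)
    rw [dist_comm p x] at t₃
    have := euclidean_stewart_of_hyperbolic (a := dist x p * q) (b := dist p y * q)
      (h := dist z p * q) (u := dist z x * q) (v := dist z y * q) (by positivity) (by positivity)
      (by positivity) (by positivity) (by positivity)
      (by rw [← add_mul]; gcongr) (by rw [← add_mul]; gcongr; linarith)
      (by rw [← add_mul]; gcongr) (by rw [← add_mul]; gcongr) (by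
        rw [← add_mul, h, dist_comm z x, dist_comm z y, ← hs]
        gcongr)
    refine le_of_mul_le_mul_right ?_ (show 0 < q ^ 3 by positivity)
    rw [← h]
    linarith
  · obtain ⟨x', y', z', p', q', e₁, e₂, e₃, e₄, e₅, e₆, e₇, e₈⟩ := h₂ rfl
    simp only at e₁ e₂ e₃ e₄ e₅ e₆ e₇ e₈
    rw [dist_self, dist_eq_zero] at e₇
    subst e₇
    have hs := FrechetGeometry.euclidean_stewart x' y' q' p' (by rw [e₁, e₄, e₅, h])
    rw [dist_comm q' x', dist_comm q' y', e₁, e₂, e₃, e₄, e₅, dist_comm q' p', dist_comm x z,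
      dist_comm y z] at hs
    rw [← hs, dist_comm z p]
    gcongr

/-- At any given scale at which shortest paths exist, a `CAT(κ)` space can be compared with a
sphere; if `κ ≤ 0`, the sphere just has to be chosen large enough. -/
theorem IsCAT.exists_hasSphericalComparison {κ : ℝ} (hM : IsCAT κ M) {L : ℝ} (hL : 0 ≤ L)
    (hLκ : 0 < κ → L < Real.pi / √κ) :
    ∃ k R : ℝ, 2 * L < R ∧ HasSphericalComparison k R M := by
  have hπ := Real.pi_pos
  rcases lt_or_ge 0 κ with hκ | hκ
  · obtain ⟨k, hk⟩ : ∃ k, k = √κ := ⟨_, rfl⟩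
    have hk0 : 0 < k := hk ▸ Real.sqrt_pos.2 hκ
    refine ⟨k, 2 * (Real.pi / k), by rw [hk]; linarith [hLκ hκ], hk0, by positivity,
      le_of_eq (by field_simp), fun x y hxy => hM.exists_shortestPath x y fun _ => ?_, ?_⟩
    · rw [← hk]; linarith
    intro x y z p hR h
    obtain ⟨-, -, h₃⟩ := hM.comparison x y z p z (fun _ => by rw [← hk]; exact hR) h (by simp)
    obtain ⟨x', y', z', p', q', e₁, e₂, e₃, e₄, e₅, e₆, e₇, e₈⟩ := h₃ hκ
    simp only [← hk] at e₁ e₂ e₃ e₄ e₅ e₆ e₇ e₈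
    have hn : ∀ u : Metric.sphere (0 : EuclideanSpace ℝ (Fin 3)) 1,
        ‖(u : EuclideanSpace ℝ (Fin 3))‖ = 1 := fun u => mem_sphere_zero_iff_norm.1 u.2
    have hqz : q' = z' := by
      rw [dist_self, div_eq_zero_iff, or_iff_left hk0.ne'] at e₇
      have hi := InnerProductGeometry.inner_eq_mul_norm_of_angle_eq_zero e₇
      rw [hn, hn, one_mul] at hi
      exact Subtype.ext ((inner_eq_one_iff_of_norm_eq_one (𝕜 := ℝ) (hn q') (hn z')).1 hi)
    subst hqz
    rw [div_eq_iff hk0.ne'] at e₁ e₂ e₃ e₄ e₅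
    rw [le_div_iff₀ hk0] at e₈
    have hs := spherical_stewart (hn x') (hn y') (hn q') (hn p')
      (by rw [e₁, e₄, e₅, ← h]; ring)
    simp only [InnerProductGeometry.angle_comm (q' : EuclideanSpace ℝ (Fin 3))] at hs
    rw [e₁, e₂, e₃, e₄, e₅] at hs
    have hc := Real.cos_le_cos_of_nonneg_of_le_pi (by positivity)
      (InnerProductGeometry.angle_le_pi _ _) e₈
    have hsin : 0 ≤ Real.sin (dist x y * k) := by
      rw [← e₁]; exact InnerProductGeometry.sin_angle_nonneg _ _
    simp only [mul_comm k, dist_comm z]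
    rw [hs]
    gcongr
  · have hk0 : 0 < Real.pi / (2 * L + 1) := by positivity
    have hkR : Real.pi / (2 * L + 1) * (2 * L + 1) = Real.pi := by field_simp
    refine ⟨Real.pi / (2 * L + 1), 2 * L + 1, by linarith, hk0, by linarith, by linarith,
      fun x y _ => hM.exists_shortestPath x y fun h => absurd hκ (not_le.2 h), ?_⟩
    intro x y z p hR h
    generalize Real.pi / (2 * L + 1) = k at *
    have hle : ∀ r : ℝ, r ≤ 2 * L + 1 → k * r ≤ Real.pi := fun r hr => by
      rw [← hkR]; gcongr
    have t₁ := dist_triangle z x p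
    have t₂ := dist_triangle_left x p z
    have t₃ := dist_triangle z p x
    have t₄ := dist_triangle_left p y z
    have t₅ := dist_triangle_right z p y
    rw [dist_comm p x] at t₃
    rw [dist_comm x z, dist_comm y z] at hR
    have n₁ : 0 ≤ dist x y := dist_nonneg
    have n₂ : 0 ≤ dist z x := dist_nonneg
    have n₃ : 0 ≤ dist z y := dist_nonneg
    have := spherical_stewart_of_euclidean (a := k * dist x p) (b := k * dist p y)
      (h := k * dist z p) (u := k * dist z x) (v := k * dist z y) (by positivity) (by positivity)
      (by positivity) (by positivity) (by positivity)
      (by rw [← mul_add]; gcongr) (by rw [← mul_add]; gcongr; linarith)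
      (by rw [← mul_add]; gcongr) (by rw [← mul_add]; gcongr) (hle _ (by linarith))
      (hle _ (by linarith)) (by rw [← mul_add]; exact hle _ (by linarith))
      (by rw [← mul_add]; exact hle _ (by linarith)) (by
        have := mul_le_mul_of_nonneg_left (hM.euclidean_stewart hκ (z := z) h)
          (show 0 ≤ k ^ 3 by positivity)
        rw [← h] at this
        linarith)
    rwa [← mul_add, h] at this

/-! ### Angles in spaces with spherical comparison -/

/-- A triangle with sides `s`, `t`, `c` has versine `1 - cos` of its Euclidean and of its spherical
comparison angle between `s` and `t` in a ratio that tends to `1` as the triangle shrinks. -/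
theorem sinc_mul_one_sub_cos_law {s t c : ℝ} (hs : s ≠ 0) (ht : t ≠ 0) (hs' : Real.sin s ≠ 0)
    (ht' : Real.sin t ≠ 0) :
    (1 - (s ^ 2 + t ^ 2 - c ^ 2) / (2 * s * t)) *
        (Real.sinc ((c + (s - t)) / 2) * Real.sinc ((c - (s - t)) / 2)) =
      (1 - (Real.cos c - Real.cos s * Real.cos t) / (Real.sin s * Real.sin t)) *
        (Real.sinc s * Real.sinc t) := by
  have hsinc : ∀ x : ℝ, x * Real.sinc x = Real.sin x := fun x => by
    by_cases hx : x = 0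
    · simp [hx]
    · rw [Real.sinc_of_ne_zero hx]; field_simp
  have h₁ := hsinc ((c + (s - t)) / 2)
  have h₂ := hsinc ((c - (s - t)) / 2)
  have h₃ : Real.cos (s - t) - Real.cos c =
      2 * (Real.sin ((c + (s - t)) / 2) * Real.sin ((c - (s - t)) / 2)) := by
    rw [Real.cos_sub_cos, show (s - t - c) / 2 = -((c - (s - t)) / 2) by ring, Real.sin_neg,
      show (s - t + c) / 2 = (c + (s - t)) / 2 by ring]
    ring
  rw [← h₁, ← h₂, Real.cos_sub] at h₃
  rw [Real.sinc_of_ne_zero hs, Real.sinc_of_ne_zero ht]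
  field_simp
  linear_combination -2 * h₃

variable {k R : ℝ}

namespace HasSphericalComparison

theorem sin_pos (hM : HasSphericalComparison k R M) {r : ℝ} (h₀ : 0 < r) (h₁ : 2 * r < R) :
    0 < Real.sin (k * r) := by
  have := hM.pos
  refine Real.sin_pos_of_pos_of_lt_pi (by positivity) ?_
  have := mul_lt_mul_of_pos_left h₁ this
  linarith [hM.mul_le]

/-- Moving a vertex `x` of a triangle `p x z` towards `p` does not increase the spherical comparison
angle at `p`. -/
theorem cos_law_mono (hM : HasSphericalComparison k R M) {p x x' z : M}
    (h : dist p x' + dist x' x = dist p x) (hR : dist p x + dist p z + dist x z < R)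
    (hpx' : 0 < dist p x') (hpz : 0 < dist p z) :
    (Real.cos (k * dist x z) - Real.cos (k * dist p x) * Real.cos (k * dist p z)) /
        (Real.sin (k * dist p x) * Real.sin (k * dist p z)) ≤
      (Real.cos (k * dist x' z) - Real.cos (k * dist p x') * Real.cos (k * dist p z)) /
        (Real.sin (k * dist p x') * Real.sin (k * dist p z)) := by
  have n : 0 ≤ dist x' x := dist_nonneg
  have t₁ := dist_triangle p z x
  have t₂ := dist_triangle p x z
  rw [dist_comm z x] at t₁
  have s₁ := hM.sin_pos (r := dist p x) (by linarith) (by linarith)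
  have s₂ := hM.sin_pos (r := dist p x') hpx' (by linarith)
  have s₃ := hM.sin_pos (r := dist p z) hpz (by linarith)
  have hs := hM.stewart p x z x' (by linarith) h
  rw [dist_comm z p, dist_comm z x, dist_comm z x'] at hs
  have e : k * dist x' x = k * dist p x - k * dist p x' := by rw [← h]; ring
  rw [e, Real.sin_sub] at hs
  rw [div_le_div_iff₀ (by positivity) (by positivity)]
  have e₂ := Real.sin_sq_add_cos_sq (k * dist p x)
  nlinarith [mul_le_mul_of_nonneg_left hs s₃.le]

end HasSphericalComparison

variable {p : M}

/-- `γ` is an isometric embedding of `[0, s]`. -/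
def IsometricUpTo (γ : ℝ → M) (s : ℝ) : Prop :=
  ∀ u ∈ Icc 0 s, ∀ v ∈ Icc 0 s, dist (γ u) (γ v) = |u - v|

theorem IsometricUpTo.mono {γ : ℝ → M} {s s' : ℝ} (h : IsometricUpTo γ s) (hs : s' ≤ s) :
    IsometricUpTo γ s' :=
  fun u hu v hv => h u ⟨hu.1, hu.2.trans hs⟩ v ⟨hv.1, hv.2.trans hs⟩

theorem UnitGeodesic.exists_isometricUpTo (γ : UnitGeodesic p) :
    ∃ ε > 0, ∀ s < ε, IsometricUpTo γ.toFun s := by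
  obtain ⟨ε, hε, h⟩ := γ.isom
  exact ⟨ε, hε, fun s hs u hu v hv => h u ⟨hu.1, hu.2.trans_lt hs⟩ v ⟨hv.1, hv.2.trans_lt hs⟩⟩

theorem UnitGeodesic.dist_source (γ : UnitGeodesic p) {s : ℝ} (h : IsometricUpTo γ.toFun s)
    (hs : 0 ≤ s) : dist p (γ.toFun s) = s := by
  have := h 0 ⟨le_rfl, hs⟩ s ⟨hs, le_rfl⟩
  rwa [γ.source, zero_sub, abs_neg, abs_of_nonneg hs] at this

/-- The cosine of the comparison angle at `p` for the points `γ₁ s` and `γ₂ t`, on the sphere of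
curvature `k ^ 2`. -/
noncomputable def sphericalCos (k : ℝ) (γ₁ γ₂ : UnitGeodesic p) (st : ℝ × ℝ) : ℝ :=
  (Real.cos (k * dist (γ₁.toFun st.1) (γ₂.toFun st.2)) - Real.cos (k * st.1) * Real.cos (k * st.2))
    / (Real.sin (k * st.1) * Real.sin (k * st.2))

theorem sphericalCos_swap (γ₁ γ₂ : UnitGeodesic p) (s t : ℝ) :
    sphericalCos k γ₂ γ₁ (t, s) = sphericalCos k γ₁ γ₂ (s, t) := by
  simp only [sphericalCos]
  rw [dist_comm, mul_comm (Real.cos (k * t)), mul_comm (Real.sin (k * t))]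

namespace HasSphericalComparison

theorem sphericalCos_le_of_le_left (hM : HasSphericalComparison k R M) {γ₁ γ₂ : UnitGeodesic p}
    {s t s' : ℝ} (h₁ : IsometricUpTo γ₁.toFun s) (h₂ : IsometricUpTo γ₂.toFun t)
    (hs' : 0 < s') (ht : 0 < t) (hs : s' ≤ s)
    (hR : s + t + dist (γ₁.toFun s) (γ₂.toFun t) < R) :
    sphericalCos k γ₁ γ₂ (s, t) ≤ sphericalCos k γ₁ γ₂ (s', t) := by
  have e₁ := γ₁.dist_source h₁ (hs'.le.trans hs)
  have e₂ := γ₁.dist_source (h₁.mono hs) hs'.le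
  have e₃ := γ₂.dist_source h₂ ht.le
  have e₄ := h₁ s' ⟨hs'.le, hs⟩ s ⟨hs'.le.trans hs, le_rfl⟩
  rw [abs_sub_comm, abs_of_nonneg (by linarith)] at e₄
  have := hM.cos_law_mono (p := p) (x := γ₁.toFun s) (x' := γ₁.toFun s') (z := γ₂.toFun t)
    (by rw [e₁, e₂, e₄]; ring) (by rw [e₁, e₃]; exact hR) (by rwa [e₂]) (by rwa [e₃])
  rwa [e₁, e₂, e₃] at this

theorem sphericalCos_le_of_le (hM : HasSphericalComparison k R M) {γ₁ γ₂ : UnitGeodesic p}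
    {s t s' t' : ℝ} (h₁ : IsometricUpTo γ₁.toFun s) (h₂ : IsometricUpTo γ₂.toFun t)
    (hs' : 0 < s') (ht' : 0 < t') (hs : s' ≤ s) (ht : t' ≤ t)
    (hR : s + t + dist (γ₁.toFun s) (γ₂.toFun t) < R) :
    sphericalCos k γ₁ γ₂ (s, t) ≤ sphericalCos k γ₁ γ₂ (s', t') := by
  refine (hM.sphericalCos_le_of_le_left h₁ h₂ hs' (ht'.trans_le ht) hs hR).trans ?_
  rw [← sphericalCos_swap, ← sphericalCos_swap γ₁]
  refine hM.sphericalCos_le_of_le_left h₂ (h₁.mono hs) ht' hs' ht ?_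
  have e₄ := h₁ s' ⟨hs'.le, hs⟩ s ⟨hs'.le.trans hs, le_rfl⟩
  rw [abs_sub_comm, abs_of_nonneg (by linarith)] at e₄
  have := dist_triangle (γ₁.toFun s') (γ₁.toFun s) (γ₂.toFun t)
  rw [dist_comm]
  linarith

theorem sphericalCos_le_one (hM : HasSphericalComparison k R M) {γ₁ γ₂ : UnitGeodesic p}
    {s t : ℝ} (h₁ : IsometricUpTo γ₁.toFun s) (h₂ : IsometricUpTo γ₂.toFun t)
    (hs : 0 < s) (ht : 0 < t) (hR : s + t + dist (γ₁.toFun s) (γ₂.toFun t) < R) :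
    sphericalCos k γ₁ γ₂ (s, t) ≤ 1 := by
  have e₁ := γ₁.dist_source h₁ hs.le
  have e₂ := γ₂.dist_source h₂ ht.le
  have t₁ := dist_triangle p (γ₁.toFun s) (γ₂.toFun t)
  have t₂ := dist_triangle_right p (γ₁.toFun s) (γ₂.toFun t)
  have s₁ := hM.sin_pos (r := s) hs (by linarith)
  have s₂ := hM.sin_pos (r := t) ht (by linarith)
  have hk := hM.pos
  simp only [sphericalCos]
  rw [div_le_one (by positivity)]
  have : Real.cos (k * dist (γ₁.toFun s) (γ₂.toFun t)) ≤ Real.cos |k * s - k * t| := by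
    refine Real.cos_le_cos_of_nonneg_of_le_pi (abs_nonneg _) ?_ ?_
    · have h₃ : k * (2 * dist (γ₁.toFun s) (γ₂.toFun t)) ≤ k * R := by
        gcongr
        have := dist_triangle_left (γ₁.toFun s) (γ₂.toFun t) p
        linarith
      linarith [hM.mul_le]
    · rw [← mul_sub, abs_mul, abs_of_pos hk]
      gcongr
      rw [abs_le]
      constructor <;> linarith
  rw [Real.cos_abs, Real.cos_sub] at this
  linarith

theorem eventually_small (hM : HasSphericalComparison k R M) (γ₁ γ₂ : UnitGeodesic p) :
    ∃ ε > 0, ∀ s ∈ Ioo 0 ε, ∀ t ∈ Ioo 0 ε, IsometricUpTo γ₁.toFun s ∧ IsometricUpTo γ₂.toFun t ∧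
      s + t + dist (γ₁.toFun s) (γ₂.toFun t) < R := by
  obtain ⟨ε₁, hε₁, H₁⟩ := γ₁.exists_isometricUpTo
  obtain ⟨ε₂, hε₂, H₂⟩ := γ₂.exists_isometricUpTo
  have hR := hM.radius_pos
  refine ⟨min (min ε₁ ε₂) (R / 4), by positivity, fun s hs t ht => ?_⟩
  have hs₁ := H₁ s (hs.2.trans_le ((min_le_left _ _).trans (min_le_left _ _)))
  have ht₂ := H₂ t (ht.2.trans_le ((min_le_left _ _).trans (min_le_right _ _)))
  refine ⟨hs₁, ht₂, ?_⟩
  have hs₂ := hs.2.trans_le (min_le_right _ _)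
  have ht₂' := ht.2.trans_le (min_le_right _ _)
  have := dist_triangle_left (γ₁.toFun s) (γ₂.toFun t) p
  rw [γ₁.dist_source hs₁ hs.1.le, γ₂.dist_source ht₂ ht.1.le] at this
  linarith

theorem exists_tendsto_sphericalCos (hM : HasSphericalComparison k R M) (γ₁ γ₂ : UnitGeodesic p) :
    ∃ G, Tendsto (sphericalCos k γ₁ γ₂) smallPairs (𝓝 G) := by
  obtain ⟨ε, hε, H⟩ := hM.eventually_small γ₁ γ₂
  obtain ⟨S, hS⟩ : ∃ S, S = sphericalCos k γ₁ γ₂ '' (Ioo 0 ε ×ˢ Ioo 0 ε) := ⟨_, rfl⟩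
  have hne : S.Nonempty := by
    rw [hS]
    exact ⟨_, mem_image_of_mem _ (mk_mem_prod ⟨half_pos hε, half_lt_self hε⟩
      ⟨half_pos hε, half_lt_self hε⟩)⟩
  have hbdd : BddAbove S := by
    refine ⟨1, ?_⟩
    rw [hS]
    rintro _ ⟨⟨s, t⟩, ⟨hs, ht⟩, rfl⟩
    obtain ⟨h₁, h₂, h₃⟩ := H s hs t ht
    exact hM.sphericalCos_le_one h₁ h₂ hs.1 ht.1 h₃
  refine ⟨sSup S, tendsto_order.2 ⟨fun a ha => ?_, fun a ha => ?_⟩⟩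
  · obtain ⟨_, hmem, hlt⟩ := exists_lt_of_lt_csSup hne ha
    rw [hS] at hmem
    obtain ⟨⟨s, t⟩, ⟨hs, ht⟩, rfl⟩ := hmem
    obtain ⟨h₁, h₂, h₃⟩ := H s hs t ht
    rw [eventually_smallPairs]
    refine ⟨min s t, lt_min hs.1 ht.1, fun s' hs' t' ht' => ?_⟩
    exact hlt.trans_le (hM.sphericalCos_le_of_le h₁ h₂ hs'.1 ht'.1
      (hs'.2.trans_le (min_le_left _ _)).le (ht'.2.trans_le (min_le_right _ _)).le h₃)
  · rw [eventually_smallPairs]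
    refine ⟨ε, hε, fun s hs t ht => (le_csSup hbdd ?_).trans_lt ha⟩
    rw [hS]
    exact mem_image_of_mem _ ⟨hs, ht⟩

theorem tendsto_fst_smallPairs : Tendsto Prod.fst smallPairs (𝓝 (0 : ℝ)) :=
  tendsto_fst.mono_right nhdsWithin_le_nhds

theorem tendsto_snd_smallPairs : Tendsto Prod.snd smallPairs (𝓝 (0 : ℝ)) :=
  tendsto_snd.mono_right nhdsWithin_le_nhds

theorem tendsto_dist_smallPairs (γ₁ γ₂ : UnitGeodesic p) :
    Tendsto (fun st : ℝ × ℝ => dist (γ₁.toFun st.1) (γ₂.toFun st.2)) smallPairs (𝓝 0) := by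
  obtain ⟨ε₁, hε₁, H₁⟩ := γ₁.exists_isometricUpTo
  obtain ⟨ε₂, hε₂, H₂⟩ := γ₂.exists_isometricUpTo
  have hadd : Tendsto (fun st : ℝ × ℝ => st.1 + st.2) smallPairs (𝓝 0) := by
    simpa using tendsto_fst_smallPairs.add tendsto_snd_smallPairs
  refine squeeze_zero' (Eventually.of_forall fun _ => dist_nonneg) ?_ hadd
  rw [eventually_smallPairs]
  refine ⟨min ε₁ ε₂, lt_min hε₁ hε₂, fun s hs t ht => ?_⟩
  have := dist_triangle_left (γ₁.toFun s) (γ₂.toFun t) p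
  rwa [γ₁.dist_source (H₁ s (hs.2.trans_le (min_le_left _ _))) hs.1.le,
    γ₂.dist_source (H₂ t (ht.2.trans_le (min_le_right _ _))) ht.1.le] at this

/-- Spherical and Euclidean comparison angles have the same limit. -/
theorem tendsto_comparisonCos_of_sphericalCos (hM : HasSphericalComparison k R M)
    {γ₁ γ₂ : UnitGeodesic p} {G : ℝ} (hG : Tendsto (sphericalCos k γ₁ γ₂) smallPairs (𝓝 G)) :
    Tendsto (comparisonCos γ₁ γ₂) smallPairs (𝓝 G) := by
  have hk := hM.pos
  have sinc_lim : ∀ u : ℝ × ℝ → ℝ, Tendsto u smallPairs (𝓝 0) →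
      Tendsto (fun st => Real.sinc (u st)) smallPairs (𝓝 1) := fun u hu => by
    have := (Real.continuous_sinc.tendsto 0).comp hu
    rwa [Real.sinc_zero] at this
  have l₁ := tendsto_fst_smallPairs.const_mul k
  have l₂ := tendsto_snd_smallPairs.const_mul k
  have l₃ := (tendsto_dist_smallPairs γ₁ γ₂).const_mul k
  have m₁ := (l₃.add (l₁.sub l₂)).div_const 2
  have m₂ := (l₃.sub (l₁.sub l₂)).div_const 2
  simp only [mul_zero, sub_zero, add_zero, zero_div] at l₁ l₂ m₁ m₂
  have hnum := (sinc_lim _ l₁).mul (sinc_lim _ l₂)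
  have hden := (sinc_lim _ m₁).mul (sinc_lim _ m₂)
  rw [mul_one] at hnum hden
  have hlim := (((hG.const_sub 1).mul hnum).div hden one_ne_zero).const_sub 1
  rw [mul_one, div_one, sub_sub_cancel] at hlim
  refine hlim.congr' ?_
  have hpos : ∀ᶠ st in smallPairs, 0 < st.1 ∧ 0 < st.2 ∧ 2 * st.1 < R ∧ 2 * st.2 < R := by
    rw [eventually_smallPairs]
    refine ⟨R / 2, half_pos hM.radius_pos, fun s hs t ht => ⟨hs.1, ht.1, ?_, ?_⟩⟩
    · linarith [hs.2]
    · linarith [ht.2]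
  filter_upwards [hpos, hden.eventually_ne one_ne_zero] with ⟨s, t⟩ ⟨hs, ht, hsR, htR⟩ hne
  simp only at hs ht hsR htR hne ⊢
  have law := sinc_mul_one_sub_cos_law (s := k * s) (t := k * t)
    (c := k * dist (γ₁.toFun s) (γ₂.toFun t)) (by positivity) (by positivity)
    (hM.sin_pos hs hsR).ne' (hM.sin_pos ht htR).ne'
  have e : ((k * s) ^ 2 + (k * t) ^ 2 - (k * dist (γ₁.toFun s) (γ₂.toFun t)) ^ 2) /
      (2 * (k * s) * (k * t)) = comparisonCos γ₁ γ₂ (s, t) := by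
    simp only [comparisonCos]; field_simp
  rw [e] at law
  rw [sub_eq_iff_eq_add', ← sub_eq_iff_eq_add]
  exact eq_div_of_mul_eq hne law

theorem tendsto_sphericalCos (hM : HasSphericalComparison k R M) (γ₁ γ₂ : UnitGeodesic p) :
    Tendsto (sphericalCos k γ₁ γ₂) smallPairs (𝓝 (Real.cos (geodesicAngle γ₁ γ₂))) := by
  obtain ⟨G, hG⟩ := hM.exists_tendsto_sphericalCos γ₁ γ₂
  rw [cos_geodesicAngle, (hM.tendsto_comparisonCos_of_sphericalCos hG).liminf_eq]
  exact hG

/-- The comparison angles converge, so that the Alexandrov angle exists as a limit. -/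
theorem tendsto_comparisonCos (hM : HasSphericalComparison k R M) (γ₁ γ₂ : UnitGeodesic p) :
    Tendsto (comparisonCos γ₁ γ₂) smallPairs (𝓝 (Real.cos (geodesicAngle γ₁ γ₂))) :=
  hM.tendsto_comparisonCos_of_sphericalCos (hM.tendsto_sphericalCos γ₁ γ₂)

/-- The Alexandrov angle is at most the spherical comparison angle. -/
theorem cos_dist_le (hM : HasSphericalComparison k R M) {γ₁ γ₂ : UnitGeodesic p}
    {s t : ℝ} (h₁ : IsometricUpTo γ₁.toFun s) (h₂ : IsometricUpTo γ₂.toFun t)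
    (hs : 0 < s) (ht : 0 < t) (hR : s + t + dist (γ₁.toFun s) (γ₂.toFun t) < R) :
    Real.cos (k * dist (γ₁.toFun s) (γ₂.toFun t)) ≤ Real.cos (k * s) * Real.cos (k * t) +
      Real.sin (k * s) * Real.sin (k * t) * Real.cos (geodesicAngle γ₁ γ₂) := by
  have hle : sphericalCos k γ₁ γ₂ (s, t) ≤ Real.cos (geodesicAngle γ₁ γ₂) := by
    refine ge_of_tendsto (hM.tendsto_sphericalCos γ₁ γ₂) (eventually_smallPairs.2
      ⟨min s t, lt_min hs ht, fun s' hs' t' ht' => ?_⟩)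
    exact hM.sphericalCos_le_of_le h₁ h₂ hs'.1 ht'.1 (hs'.2.trans_le (min_le_left _ _)).le
      (ht'.2.trans_le (min_le_right _ _)).le hR
  have e₁ := γ₁.dist_source h₁ hs.le
  have e₂ := γ₂.dist_source h₂ ht.le
  have t₁ := dist_triangle p (γ₁.toFun s) (γ₂.toFun t)
  have t₂ := dist_triangle_right p (γ₁.toFun s) (γ₂.toFun t)
  have s₁ := hM.sin_pos (r := s) hs (by linarith)
  have s₂ := hM.sin_pos (r := t) ht (by linarith)
  simp only [sphericalCos] at hle
  rw [div_le_iff₀ (by positivity)] at hle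
  linarith

end HasSphericalComparison

/-! ### The tangent cone as a blow-up -/

theorem Direction.angle_le_pi (v w : Direction p) : v.angle w ≤ Real.pi := by
  induction v using Quotient.ind with
  | _ γ =>
  induction w using Quotient.ind with
  | _ γ' => exact geodesicAngle_le_pi γ γ'

theorem Direction.angle_comm (v w : Direction p) : v.angle w = w.angle v := by
  induction v using Quotient.ind with
  | _ γ =>
  induction w using Quotient.ind with
  | _ γ' => exact geodesicAngle_comm γ γ'

theorem Direction.angle_triangle (u v w : Direction p) : u.angle w ≤ u.angle v + v.angle w := by
  induction u using Quotient.ind with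
  | _ γ₁ =>
  induction v using Quotient.ind with
  | _ γ₂ =>
  induction w using Quotient.ind with
  | _ γ₃ => exact geodesicAngle_triangle γ₁ γ₂ γ₃

/-- A geodesic representing a direction. -/
noncomputable def Direction.out (v : Direction p) : UnitGeodesic p :=
  Quotient.out (s := directionSetoid p) v

theorem Direction.geodesicAngle_out (v w : Direction p) :
    geodesicAngle v.out w.out = v.angle w := by
  have hv : (⟦v.out⟧ : Quotient (directionSetoid p)) = v := Quotient.out_eq _
  have hw : (⟦w.out⟧ : Quotient (directionSetoid p)) = w := Quotient.out_eq _
  conv_rhs => rw [← hv, ← hw]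
  rfl

theorem tendsto_mul_smallPairs {r r' : ℝ} (hr : 0 < r) (hr' : 0 < r') :
    Tendsto (fun t : ℝ => (t * r, t * r')) (𝓝[>] 0) smallPairs := by
  have h : ∀ c : ℝ, 0 < c → Tendsto (fun t : ℝ => t * c) (𝓝[>] 0) (𝓝[>] 0) := fun c hc => by
    refine tendsto_nhdsWithin_iff.2 ⟨?_, ?_⟩
    · have : Tendsto (fun t : ℝ => t * c) (𝓝 0) (𝓝 (0 * c)) := tendsto_id.mul_const c
      rw [zero_mul] at this
      exact this.mono_left nhdsWithin_le_nhds
    · filter_upwards [self_mem_nhdsWithin] with t ht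
      exact mul_pos ht hc
  exact (h r hr).prodMk (h r' hr')

theorem UnitGeodesic.eventually_dist_source (γ : UnitGeodesic p) {r : ℝ} (hr : 0 < r) :
    ∀ᶠ t in 𝓝[>] (0 : ℝ), dist p (γ.toFun (t * r)) = t * r := by
  obtain ⟨ε, hε, h⟩ := γ.exists_isometricUpTo
  have hpos : 0 < ε / r := by positivity
  filter_upwards [Ioo_mem_nhdsGT hpos] with t ht
  exact γ.dist_source (h _ ((lt_div_iff₀ hr).1 ht.2)) (mul_pos ht.1 hr).le

namespace TangentCone

/-- A curve `t ↦ exp (t V)` in `M` with initial velocity `V`. -/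
noncomputable def curve : TangentCone p → ℝ → M
  | none => fun _ => p
  | some (v, r) => fun t => v.out.toFun (t * r)

theorem mk_of_pos {r : ℝ} (hr : 0 < r) (v : Direction p) :
    mk v r = (some (v, ⟨r, hr⟩) : Option (Direction p × Ioi (0 : ℝ))) := dif_pos hr

theorem eq_apex_or_mk (V : TangentCone p) : V = apex p ∨ ∃ v r, 0 < r ∧ V = mk v r := by
  match V with
  | none => exact Or.inl rfl
  | some (v, r) =>
    have hr : (0 : ℝ) < r := r.2
    exact Or.inr ⟨v, r, hr, (mk_of_pos hr v).symm⟩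

theorem length_mk {r : ℝ} (hr : 0 < r) (v : Direction p) : (mk v r).length = r := by
  rw [mk_of_pos hr]; rfl

theorem angle_mk_mk {r s : ℝ} (hr : 0 < r) (hs : 0 < s) (v w : Direction p) :
    (mk v r).angle (mk w s) = v.angle w := by
  rw [mk_of_pos hr, mk_of_pos hs]; rfl

theorem inner_mk_mk {r s : ℝ} (hr : 0 < r) (hs : 0 < s) (v w : Direction p) :
    (mk v r).inner (mk w s) = r * s * Real.cos (v.angle w) := by
  rw [inner, angle_mk_mk hr hs, length_mk hr, length_mk hs]

theorem curve_mk {r : ℝ} (hr : 0 < r) (v : Direction p) (t : ℝ) :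
    (mk v r).curve t = v.out.toFun (t * r) := by
  rw [mk_of_pos hr]; rfl

theorem scale_mk {r : ℝ} (hr : 0 < r) (v : Direction p) (c : ℝ) :
    scale c (mk v r) = mk v (c * r) := by
  rw [mk_of_pos hr]; rfl

theorem inner_apex_right (V : TangentCone p) : inner V (apex p) = 0 := by
  rw [inner, show (apex p).length = 0 from rfl, mul_zero, zero_mul]

theorem inner_apex_left (V : TangentCone p) : inner (apex p) V = 0 := by
  rw [inner, show (apex p).length = 0 from rfl, zero_mul, zero_mul]

theorem inner_comm (V W : TangentCone p) : inner V W = inner W V := by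
  obtain rfl | ⟨v, r, hr, rfl⟩ := V.eq_apex_or_mk
  · rw [inner_apex_left, inner_apex_right]
  obtain rfl | ⟨w, s, hs, rfl⟩ := W.eq_apex_or_mk
  · rw [inner_apex_left, inner_apex_right]
  rw [inner_mk_mk hr hs, inner_mk_mk hs hr, Direction.angle_comm, mul_comm r]

theorem dist_eq (V W : TangentCone p) :
    dist V W = √(V.length ^ 2 + W.length ^ 2 - 2 * inner V W) := rfl

theorem dist_sq (V W : TangentCone p) :
    dist V W ^ 2 = V.length ^ 2 + W.length ^ 2 - 2 * inner V W := by
  rw [dist_eq, Real.sq_sqrt]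
  have h : inner V W ≤ V.length * W.length :=
    mul_le_of_le_one_right (mul_nonneg V.length_nonneg W.length_nonneg) (Real.cos_le_one _)
  nlinarith [sq_nonneg (V.length - W.length)]

theorem dist_apex (V : TangentCone p) : dist V (apex p) = V.length := by
  rw [dist_eq, inner_apex_right, show (apex p).length = 0 from rfl]
  simp [Real.sqrt_sq V.length_nonneg]

theorem continuous_inner_left (U : TangentCone p) :
    Continuous fun V : TangentCone p => inner V U := by
  have : (fun V : TangentCone p => inner V U) =
      fun V => (dist V (apex p) ^ 2 + U.length ^ 2 - dist V U ^ 2) / 2 := by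
    funext V
    rw [dist_sq V U, dist_apex]
    ring
  rw [this]
  fun_prop

theorem scale_zero (V : TangentCone p) : scale 0 V = apex p := by
  obtain rfl | ⟨v, r, hr, rfl⟩ := V.eq_apex_or_mk
  · rfl
  · rw [scale_mk hr, zero_mul]
    exact dif_neg (lt_irrefl _)

theorem length_scale {c : ℝ} (hc : 0 ≤ c) (V : TangentCone p) :
    (scale c V).length = c * V.length := by
  rcases hc.eq_or_lt with rfl | hc'
  · rw [scale_zero, zero_mul]
    rfl
  obtain rfl | ⟨v, r, hr, rfl⟩ := V.eq_apex_or_mk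
  · exact (mul_zero c).symm
  · rw [scale_mk hr, length_mk hr, length_mk (mul_pos hc' hr)]

theorem inner_scale_right {c : ℝ} (hc : 0 ≤ c) (V W : TangentCone p) :
    inner V (scale c W) = c * inner V W := by
  rcases hc.eq_or_lt with rfl | hc'
  · rw [scale_zero, inner_apex_right, zero_mul]
  obtain rfl | ⟨w, r, hr, rfl⟩ := W.eq_apex_or_mk
  · rw [show scale c (apex p) = apex p from rfl, inner_apex_right, mul_zero]
  obtain rfl | ⟨v, s, hs, rfl⟩ := V.eq_apex_or_mk
  · rw [inner_apex_left, inner_apex_left, mul_zero]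
  rw [scale_mk hr, inner_mk_mk hs hr, inner_mk_mk hs (mul_pos hc' hr)]
  ring

/-- The distances of `M`, rescaled at `p`, converge to those of the tangent cone. -/
theorem tendsto_dist_curve (hM : HasSphericalComparison k R M) (V W : TangentCone p) :
    Tendsto (fun t => dist (V.curve t) (W.curve t) / t) (𝓝[>] 0) (𝓝 (dist V W)) := by
  have apex_left : ∀ W : TangentCone p,
      Tendsto (fun t => dist p (W.curve t) / t) (𝓝[>] 0) (𝓝 W.length) := by
    intro W
    obtain rfl | ⟨w, r, hr, rfl⟩ := W.eq_apex_or_mk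
    · simp [curve, apex, length]
    · refine tendsto_const_nhds.congr' ?_
      filter_upwards [w.out.eventually_dist_source hr, self_mem_nhdsWithin] with t ht ht0
      have : t ≠ 0 := ne_of_gt ht0
      rw [curve_mk hr, length_mk hr, ht]
      field_simp
  obtain rfl | ⟨v, r, hr, rfl⟩ := V.eq_apex_or_mk
  · rw [dist_comm, dist_apex]
    exact apex_left W
  obtain rfl | ⟨w, s, hs, rfl⟩ := W.eq_apex_or_mk
  · simp only [dist_comm (curve (mk v r) _)]
    rw [dist_apex]
    exact apex_left _
  have hc := (hM.tendsto_comparisonCos v.out w.out).comp (tendsto_mul_smallPairs hr hs)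
  rw [Direction.geodesicAngle_out] at hc
  have hd := ((hc.const_mul (r * s)).const_mul 2).const_sub (r ^ 2 + s ^ 2)
  rw [dist_eq, inner_mk_mk hr hs, length_mk hr, length_mk hs]
  refine hd.sqrt.congr' ?_
  filter_upwards [self_mem_nhdsWithin] with t ht
  have ht0 : 0 < t := ht
  rw [curve_mk hr, curve_mk hs, ← Real.sqrt_sq (show 0 ≤
    dist (v.out.toFun (t * r)) (w.out.toFun (t * s)) / t by positivity)]
  congr 1
  simp only [Function.comp, comparisonCos]
  field_simp
  ring

end TangentCone

/-- Stewart's inequality on the sphere in terms of the function `sinc`, which shows how it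
degenerates to the Euclidean one for small triangles. -/
theorem HasSphericalComparison.stewart_sinc (hM : HasSphericalComparison k R M) {x y z m : M}
    {l : ℝ} (hR : dist x y + dist y z + dist x z < R) (hxy : 0 < dist x y)
    (hxm : dist x m = l * dist x y) (hmy : dist m y = (1 - l) * dist x y) :
    dist z m ^ 2 * (Real.sinc (k * dist x y) * Real.sinc (k * dist z m / 2) ^ 2) ≤
      (1 - l) * dist z x ^ 2 *
          (Real.sinc (k * ((1 - l) * dist x y)) * Real.sinc (k * dist z x / 2) ^ 2) +
        l * dist z y ^ 2 * (Real.sinc (k * (l * dist x y)) * Real.sinc (k * dist z y / 2) ^ 2) -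
        l * (1 - l) * dist x y ^ 2 * (Real.sinc (k * (l * dist x y) / 2) *
          Real.sinc (k * ((1 - l) * dist x y) / 2) * Real.sinc (k * dist x y / 2)) := by
  have hk := hM.pos
  have hs := hM.stewart x y z m hR (by rw [hxm, hmy]; ring)
  rw [hxm, hmy] at hs
  have hsinc : ∀ x : ℝ, Real.sin x = x * Real.sinc x := fun x => by
    by_cases hx : x = 0
    · simp [hx]
    · rw [Real.sinc_of_ne_zero hx]; field_simp
  have hcos : ∀ x : ℝ, Real.cos x = 1 - x ^ 2 / 2 * Real.sinc (x / 2) ^ 2 := fun x => by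
    have h₁ := Real.cos_two_mul (x / 2)
    have h₂ := Real.sin_sq_add_cos_sq (x / 2)
    rw [mul_div_cancel₀ x two_ne_zero] at h₁
    rw [hsinc (x / 2)] at h₂
    linear_combination h₁ + 2 * h₂
  have hsum : ∀ a b : ℝ, Real.sin a + Real.sin b - Real.sin (a + b) =
      4 * Real.sin (a / 2) * Real.sin (b / 2) * Real.sin ((a + b) / 2) := fun a b => by
    have ha := Real.sin_two_mul (a / 2)
    have hb := Real.sin_two_mul (b / 2)
    have hab := Real.sin_two_mul ((a + b) / 2)
    have ca := Real.sin_sq_add_cos_sq (a / 2)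
    have cb := Real.sin_sq_add_cos_sq (b / 2)
    rw [mul_div_cancel₀ _ two_ne_zero] at ha hb hab
    rw [ha, hb, hab, add_div, Real.sin_add, Real.cos_add]
    linear_combination (2 * Real.sin (b / 2) * Real.cos (b / 2)) * (-ca)
      + (2 * Real.sin (a / 2) * Real.cos (a / 2)) * (-cb)
  have h₀ := hsum (k * (l * dist x y)) (k * ((1 - l) * dist x y))
  rw [show k * (l * dist x y) + k * ((1 - l) * dist x y) = k * dist x y by ring] at h₀
  rw [hcos (k * dist z x), hcos (k * dist z y), hcos (k * dist z m)] at hs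
  rw [hsinc (k * (l * dist x y) / 2), hsinc (k * ((1 - l) * dist x y) / 2),
    hsinc (k * dist x y / 2)] at h₀
  have e₁ := hsinc (k * (l * dist x y))
  have e₂ := hsinc (k * ((1 - l) * dist x y))
  have e₃ := hsinc (k * dist x y)
  rw [mul_sub, mul_sub, mul_sub, mul_one, mul_one, mul_one] at hs
  refine le_of_mul_le_mul_left ?_ (show 0 < k ^ 3 * dist x y / 2 by positivity)
  rw [e₁, e₂, e₃] at hs h₀
  linarith

theorem IsShortestPath.dist_left {γ : ℝ → M} {x y : M} (h : IsShortestPath γ x y) {s : ℝ}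
    (hs : s ∈ Icc 0 (dist x y)) : dist x (γ s) = s := by
  have := h.isom 0 ⟨le_rfl, dist_nonneg⟩ s hs
  rwa [h.source, zero_sub, abs_neg, abs_of_nonneg hs.1] at this

theorem IsShortestPath.dist_right {γ : ℝ → M} {x y : M} (h : IsShortestPath γ x y) {s : ℝ}
    (hs : s ∈ Icc 0 (dist x y)) : dist (γ s) y = dist x y - s := by
  have := h.isom s hs (dist x y) ⟨dist_nonneg, le_rfl⟩
  rwa [h.target, abs_sub_comm, abs_of_nonneg (by linarith [hs.2])] at this

/-- In a triangle that shrinks to a point, Stewart's inequality becomes the Euclidean one to leading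
order. -/
theorem HasSphericalComparison.exists_stewart_limit (hM : HasSphericalComparison k R M)
    {x y z m : ℝ → M} {l A B D : ℝ} (hD : 0 < D)
    (hxy : Tendsto (fun t => dist (x t) (y t) / t) (𝓝[>] 0) (𝓝 D))
    (hzx : Tendsto (fun t => dist (z t) (x t) / t) (𝓝[>] 0) (𝓝 A))
    (hzy : Tendsto (fun t => dist (z t) (y t) / t) (𝓝[>] 0) (𝓝 B))
    (hxm : ∀ᶠ t in 𝓝[>] 0, dist (x t) (m t) = l * dist (x t) (y t))
    (hmy : ∀ᶠ t in 𝓝[>] 0, dist (m t) (y t) = (1 - l) * dist (x t) (y t)) :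
    ∃ E : ℝ → ℝ, Tendsto E (𝓝[>] 0) (𝓝 ((1 - l) * A ^ 2 + l * B ^ 2 - l * (1 - l) * D ^ 2)) ∧
      ∀ᶠ t in 𝓝[>] 0, (dist (z t) (m t) / t) ^ 2 ≤ E t := by
  have hid : Tendsto (fun t : ℝ => t) (𝓝[>] 0) (𝓝 0) := nhdsWithin_le_nhds
  have hpos : ∀ᶠ t : ℝ in 𝓝[>] 0, 0 < t := self_mem_nhdsWithin
  have small : ∀ (d : ℝ → ℝ) (a : ℝ), Tendsto (fun t => d t / t) (𝓝[>] 0) (𝓝 a) →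
      Tendsto d (𝓝[>] 0) (𝓝 0) := fun d a h => by
    have := h.mul hid
    rw [mul_zero] at this
    refine this.congr' ?_
    filter_upwards [hpos] with t ht
    field_simp
  have sinc_lim : ∀ u : ℝ → ℝ, Tendsto u (𝓝[>] 0) (𝓝 0) →
      Tendsto (fun t => Real.sinc (u t)) (𝓝[>] 0) (𝓝 1) := fun u hu => by
    have := (Real.continuous_sinc.tendsto 0).comp hu
    rwa [Real.sinc_zero] at this
  have sxy := small _ _ hxy
  have szx := small _ _ hzx
  have szy := small _ _ hzy
  have szm : Tendsto (fun t => dist (z t) (m t)) (𝓝[>] 0) (𝓝 0) := by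
    have h := szx.add (sxy.const_mul l)
    rw [mul_zero, add_zero] at h
    refine squeeze_zero' (Eventually.of_forall fun _ => dist_nonneg) ?_ h
    filter_upwards [hxm] with t ht
    rw [← ht]
    exact dist_triangle _ _ _
  have scale : ∀ (d : ℝ → ℝ) (c : ℝ), Tendsto d (𝓝[>] 0) (𝓝 0) →
      Tendsto (fun t => Real.sinc (k * (c * d t))) (𝓝[>] 0) (𝓝 1) := fun d c h => by
    refine sinc_lim _ ?_
    have := (h.const_mul c).const_mul k
    simpa using this
  have half : ∀ (d : ℝ → ℝ) (c : ℝ), Tendsto d (𝓝[>] 0) (𝓝 0) →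
      Tendsto (fun t => Real.sinc (k * (c * d t) / 2)) (𝓝[>] 0) (𝓝 1) := fun d c h => by
    refine sinc_lim _ ?_
    have := ((h.const_mul c).const_mul k).div_const 2
    simpa using this
  have hden := (scale _ 1 sxy).mul ((half _ 1 szm).pow 2)
  have hnum := (((hzx.pow 2).const_mul (1 - l)).mul
      ((scale _ (1 - l) sxy).mul ((half _ 1 szx).pow 2))).add
    (((hzy.pow 2).const_mul l).mul ((scale _ l sxy).mul ((half _ 1 szy).pow 2))) |>.sub
    (((hxy.pow 2).const_mul (l * (1 - l))).mul
      (((half _ l sxy).mul (half _ (1 - l) sxy)).mul (half _ 1 sxy)))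
  simp only [one_mul, one_pow, mul_one] at hden hnum
  have hE := hnum.div hden one_ne_zero
  rw [div_one] at hE
  refine ⟨_, hE, ?_⟩
  have hsum := (sxy.add szy).add szx
  simp only [add_zero] at hsum
  filter_upwards [hpos, hxm, hmy, hsum.eventually_lt_const hM.radius_pos,
    hxy.eventually_const_lt hD, hden.eventually_const_lt one_pos] with t ht h₁ h₂ h₃ h₄ h₅
  rw [Pi.div_apply, le_div_iff₀ h₅]
  have hd : 0 < dist (x t) (y t) := by
    have := mul_pos h₄ ht
    rwa [div_mul_cancel₀ _ ht.ne'] at this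
  have hs := hM.stewart_sinc (x := x t) (y := y t) (z := z t) (m := m t) (l := l)
    (by rwa [dist_comm (y t), dist_comm (x t) (z t)]) hd h₁ h₂
  refine le_of_mul_le_mul_left ?_ (show 0 < t ^ 2 by positivity)
  calc _ = _ := ?_
    _ ≤ _ := hs
    _ = _ := ?_
  · field_simp
  · field_simp

namespace TangentCone

/-- The tangent cone satisfies the inequality that defines nonpositive curvature, for all points `P`
that lie between `V` and `W`. (The tangent cone need not be a geodesic space.) -/
theorem stewart (hM : HasSphericalComparison k R M) {V W U P : TangentCone p}
    (h : dist V P + dist P W = dist V W) :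
    dist V W * (dist U P ^ 2 + dist V P * dist P W) ≤
      dist P W * dist U V ^ 2 + dist V P * dist U W ^ 2 := by
  have hVP : 0 ≤ dist V P := dist_nonneg
  have hPW : 0 ≤ dist P W := dist_nonneg
  rcases (dist_nonneg : 0 ≤ dist V W).eq_or_lt with h0 | hD
  · have e₁ : dist V P = 0 := by linarith
    have e₂ : dist P W = 0 := by linarith
    simp [← h0, e₁, e₂]
  obtain ⟨D, hDdef⟩ : ∃ D, D = dist V W := ⟨_, rfl⟩
  rw [← hDdef] at hD h ⊢
  obtain ⟨l, hl⟩ : ∃ l, l = dist V P / D := ⟨_, rfl⟩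
  have e₁ : dist V P = l * D := by rw [hl]; field_simp
  have e₂ : dist P W = (1 - l) * D := by linarith
  have hl0 : 0 ≤ l := by rw [hl]; positivity
  have hl1 : 0 ≤ 1 - l := by
    rw [e₂] at hPW
    exact nonneg_of_mul_nonneg_left hPW hD
  have hxy := tendsto_dist_curve hM V W
  rw [← hDdef] at hxy
  have hm : ∀ t, ∃ m : M, dist (V.curve t) (W.curve t) < R / 2 →
      dist (V.curve t) m = l * dist (V.curve t) (W.curve t) ∧
        dist m (W.curve t) = (1 - l) * dist (V.curve t) (W.curve t) := fun t => by
    by_cases hR : dist (V.curve t) (W.curve t) < R / 2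
    · obtain ⟨σ, hσ⟩ := hM.exists_shortestPath _ _ hR
      have hmem : l * dist (V.curve t) (W.curve t) ∈ Icc 0 (dist (V.curve t) (W.curve t)) :=
        ⟨by positivity, mul_le_of_le_one_left dist_nonneg (by linarith)⟩
      refine ⟨σ (l * dist (V.curve t) (W.curve t)), fun _ => ⟨hσ.dist_left hmem, ?_⟩⟩
      rw [hσ.dist_right hmem]
      ring
    · exact ⟨p, fun h => absurd h hR⟩
  choose m hm using hm
  have hclose : ∀ᶠ t in 𝓝[>] 0, dist (V.curve t) (W.curve t) < R / 2 := by
    have hid : Tendsto (fun t : ℝ => t) (𝓝[>] 0) (𝓝 0) := nhdsWithin_le_nhds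
    have := hxy.mul hid
    rw [mul_zero] at this
    filter_upwards [this.eventually_lt_const (half_pos hM.radius_pos), self_mem_nhdsWithin]
      with t ht ht0
    rwa [div_mul_cancel₀ _ (ne_of_gt ht0)] at ht
  have hxm := hclose.mono fun t ht => (hm t ht).1
  have hmy := hclose.mono fun t ht => (hm t ht).2
  -- The point `m t` approximates `P` to first order, by the inequality for `z = P`.
  obtain ⟨E, hE, hUm⟩ := hM.exists_stewart_limit (z := U.curve) hD hxy
    (tendsto_dist_curve hM U V) (tendsto_dist_curve hM U W) hxm hmy
  obtain ⟨E', hE', hPm⟩ := hM.exists_stewart_limit (z := P.curve) hD hxy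
    (tendsto_dist_curve hM P V) (tendsto_dist_curve hM P W) hxm hmy
  rw [dist_comm P V, e₁, e₂, show (1 - l) * (l * D) ^ 2 + l * ((1 - l) * D) ^ 2 -
    l * (1 - l) * D ^ 2 = 0 by ring] at hE'
  have hE0 := ge_of_tendsto hE (hUm.mono fun t ht => (sq_nonneg _).trans ht)
  have hle : dist U P ≤ √((1 - l) * dist U V ^ 2 + l * dist U W ^ 2 - l * (1 - l) * D ^ 2) := by
    have hsum := hE.sqrt.add hE'.sqrt
    rw [Real.sqrt_zero, add_zero] at hsum
    refine le_of_tendsto_of_tendsto (tendsto_dist_curve hM U P) hsum ?_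
    filter_upwards [hUm, hPm, self_mem_nhdsWithin] with t h₁ h₂ ht
    have ht0 : 0 < t := ht
    have k₁ := Real.le_sqrt_of_sq_le h₁
    have k₂ := Real.le_sqrt_of_sq_le h₂
    have k₃ : dist (U.curve t) (P.curve t) / t ≤
        dist (U.curve t) (m t) / t + dist (P.curve t) (m t) / t := by
      rw [← add_div]
      gcongr
      exact dist_triangle_right _ _ _
    linarith
  have hsq := (Real.le_sqrt dist_nonneg hE0).1 hle
  rw [e₁, e₂]
  nlinarith [mul_le_mul_of_nonneg_left hsq hD.le]

/-- The inner product with a fixed vector is concave along shortest paths: up to sign it is a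
Busemann function of the tangent cone. -/
theorem inner_concave (hM : HasSphericalComparison k R M) {V W P : TangentCone p}
    (h : dist V P + dist P W = dist V W) (U : TangentCone p) :
    dist P W * inner V U + dist V P * inner W U ≤ dist V W * inner P U := by
  by_contra! hlt
  obtain ⟨δ, hδ⟩ : ∃ δ, δ = dist P W * inner V U + dist V P * inner W U -
    dist V W * inner P U := ⟨_, rfl⟩
  have hδ0 : 0 < δ := by linarith
  obtain ⟨C, hC⟩ : ∃ C, C = dist P W * V.length ^ 2 + dist V P * W.length ^ 2 -
    dist V W * (P.length ^ 2 + dist V P * dist P W) := ⟨_, rfl⟩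
  have key : ∀ s : ℝ, 0 ≤ s → 2 * s * δ ≤ C := fun s hs => by
    have := stewart hM (U := scale s U) h
    rw [dist_comm _ P, dist_comm (scale s U) V, dist_comm (scale s U) W, dist_sq, dist_sq, dist_sq,
      inner_scale_right hs, inner_scale_right hs, inner_scale_right hs, length_scale hs] at this
    rw [hδ, hC]
    have e := congrArg (fun r => r * (s * U.length) ^ 2) h
    linarith
  have := key ((|C| + 1) / δ) (by positivity)
  rw [mul_assoc, div_mul_cancel₀ _ hδ0.ne'] at this
  linarith [le_abs_self C, abs_nonneg C]

/-- The angles of any vector with two opposite directions add up to at least `π`, so their cosines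
have nonpositive sum. -/
theorem inner_add_inner_nonpos {Z X : TangentCone p} (hZ : Z.length = 1) (hX : X.length = 1)
    (h : Real.pi ≤ Z.angle X) (W : TangentCone p) : inner W Z + inner W X ≤ 0 := by
  obtain rfl | ⟨z, r, hr, rfl⟩ := Z.eq_apex_or_mk
  · exact absurd hZ (by simp [apex, length])
  obtain rfl | ⟨x, s, hs, rfl⟩ := X.eq_apex_or_mk
  · exact absurd hX (by simp [apex, length])
  obtain rfl | ⟨w, q, hq, rfl⟩ := W.eq_apex_or_mk
  · rw [inner_apex_left, inner_apex_left, add_zero]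
  rw [length_mk hr] at hZ
  rw [length_mk hs] at hX
  subst hZ hX
  rw [angle_mk_mk hr hs] at h
  rw [inner_mk_mk hq hr, inner_mk_mk hq hs, mul_one, ← mul_add]
  refine mul_nonpos_of_nonneg_of_nonpos hq.le ?_
  have t := Direction.angle_triangle z w x
  rw [Direction.angle_comm z w] at t
  have := Real.cos_le_cos_of_nonneg_of_le_pi (x := Real.pi - w.angle x) (y := w.angle z)
    (by linarith [w.angle_le_pi x]) (w.angle_le_pi z) (by linarith)
  rw [Real.cos_pi_sub] at this
  linarith

/-- The vectors that lie on the boundary between two opposite directions, in the sense that their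
angles with these add up to `π`, form a convex cone. -/
theorem isConvexCone_inner_add_inner_eq_zero (hM : HasSphericalComparison k R M)
    {Z X : TangentCone p} (h : ∀ W : TangentCone p, inner W Z + inner W X ≤ 0) :
    IsConvexCone {W : TangentCone p | inner W Z + inner W X = 0} where
  scale_mem c hc V hV := by
    rw [mem_ofPred_eq] at hV ⊢
    rw [inner_comm, inner_scale_right hc, inner_comm (scale c V), inner_scale_right hc, ← mul_add,
      inner_comm Z, inner_comm X, hV, mul_zero]
  convex V hV W hW γ hγ t ht := by
    rw [mem_ofPred_eq] at hV hW ⊢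
    refine le_antisymm (h _) ?_
    have hbtw : dist V (γ t) + dist (γ t) W = dist V W := by
      rw [hγ.dist_left ht, hγ.dist_right ht]; ring
    rcases (dist_nonneg : 0 ≤ dist V W).eq_or_lt with h0 | hD
    · have : V = γ t := by
        rw [← dist_eq_zero]
        linarith [dist_nonneg (x := V) (y := γ t), dist_nonneg (x := γ t) (y := W)]
      rw [← this, hV]
    · have h₁ := inner_concave hM hbtw Z
      have h₂ := inner_concave hM hbtw X
      refine le_of_mul_le_mul_left ?_ hD
      rw [mul_zero]
      calc 0 = dist (γ t) W * (inner V Z + inner V X) +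
            dist V (γ t) * (inner W Z + inner W X) := by rw [hV, hW]; ring
        _ ≤ dist V W * (inner (γ t) Z + inner (γ t) X) := by linarith

end TangentCone

/-! ### First variation of the distance -/

/-- Two shortest paths whose lengths add up to the distance of their outer endpoints can be joined
to a shortest path. -/
theorem exists_isShortestPath_through {α β : ℝ → M} {x y z : M} (hα : IsShortestPath α x y)
    (hβ : IsShortestPath β y z) (h : dist x y + dist y z = dist x z) :
    ∃ σ : ℝ → M, IsShortestPath σ x z ∧ σ (dist x y) = y := by
  obtain ⟨σ, hσ⟩ : ∃ σ : ℝ → M, σ = fun s => if s ≤ dist x y then α s else β (s - dist x y) :=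
    ⟨_, rfl⟩
  have e₁ : ∀ s, s ≤ dist x y → σ s = α s := fun s hs => by rw [hσ]; exact if_pos hs
  have e₂ : ∀ s, dist x y ≤ s → σ s = β (s - dist x y) := fun s hs => by
    rcases hs.eq_or_lt with rfl | hs
    · rw [e₁ _ le_rfl, hα.target, sub_self, hβ.source]
    · rw [hσ]; exact if_neg (not_le.2 hs)
  have n₁ : 0 ≤ dist x y := dist_nonneg
  have n₂ : 0 ≤ dist y z := dist_nonneg
  have d₁ : ∀ s ∈ Icc 0 (dist x y), dist (σ s) y = dist x y - s ∧ dist x (σ s) = s :=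
    fun s hs => by rw [e₁ s hs.2]; exact ⟨hα.dist_right hs, hα.dist_left hs⟩
  have d₂ : ∀ s ∈ Icc (dist x y) (dist x z), dist y (σ s) = s - dist x y ∧
      dist (σ s) z = dist x z - s := fun s hs => by
    have hmem : s - dist x y ∈ Icc 0 (dist y z) := ⟨by linarith [hs.1], by linarith [hs.2]⟩
    rw [e₂ s hs.1]
    exact ⟨hβ.dist_left hmem, by rw [hβ.dist_right hmem]; linarith⟩
  have main : ∀ s ∈ Icc 0 (dist x z), ∀ t ∈ Icc 0 (dist x z), s ≤ t →
      dist (σ s) (σ t) = t - s := fun s hs t ht hst => by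
    rcases le_total t (dist x y) with h₁ | h₁
    · rw [e₁ t h₁, e₁ s (hst.trans h₁), hα.isom s ⟨hs.1, hst.trans h₁⟩ t ⟨ht.1, h₁⟩,
        abs_sub_comm, abs_of_nonneg (by linarith)]
    rcases le_total s (dist x y) with h₂ | h₂
    · obtain ⟨a₁, a₂⟩ := d₁ s ⟨hs.1, h₂⟩
      obtain ⟨b₁, b₂⟩ := d₂ t ⟨h₁, ht.2⟩
      have t₁ := dist_triangle (σ s) y (σ t)
      have t₂ := dist_triangle4 x (σ s) (σ t) z
      linarith
    · rw [e₂ t h₁, e₂ s h₂, hβ.isom _ ⟨by linarith, by linarith [hs.2]⟩ _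
        ⟨by linarith, by linarith [ht.2]⟩, abs_sub_comm, abs_of_nonneg (by linarith)]
      ring
  refine ⟨σ, ⟨by rw [e₁ 0 n₁, hα.source], ?_, fun s hs t ht => ?_⟩, by rw [e₁ _ le_rfl, hα.target]⟩
  · rw [e₂ _ (by linarith), ← h, add_sub_cancel_left, hβ.target]
  · rcases le_total s t with hst | hst
    · rw [main s hs t ht hst, abs_sub_comm, abs_of_nonneg (by linarith)]
    · rw [dist_comm, main t ht s hs hst, abs_of_nonneg (by linarith)]

theorem UnitGeodesic.eventually_isometricUpTo (γ : UnitGeodesic p) :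
    ∀ᶠ t in 𝓝[>] (0 : ℝ), 0 < t ∧ IsometricUpTo γ.toFun t ∧ dist p (γ.toFun t) = t := by
  obtain ⟨ε, hε, h⟩ := γ.exists_isometricUpTo
  filter_upwards [Ioo_mem_nhdsGT hε] with t ht
  exact ⟨ht.1, h t ht.2, γ.dist_source (h t ht.2) ht.1.le⟩

theorem UnitGeodesic.tendsto_source (γ : UnitGeodesic p) :
    Tendsto γ.toFun (𝓝[>] 0) (𝓝 p) := by
  rw [tendsto_iff_dist_tendsto_zero]
  have hid : Tendsto (fun t : ℝ => t) (𝓝[>] 0) (𝓝 0) := nhdsWithin_le_nhds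
  refine hid.congr' ?_
  filter_upwards [γ.eventually_isometricUpTo] with t ht
  rw [dist_comm, ht.2.2]

namespace HasSphericalComparison

/-- In a comparison space, shortest paths to a point `x` that is not too far away depend
continuously on their starting point. -/
theorem tendsto_shortestPath_point (hM : HasSphericalComparison k R M) {x : M} {σ : ℝ → M}
    (hσ : IsShortestPath σ p x) (hR : 2 * dist p x < R) {r : ℝ} (hr : 0 < r)
    (hrR : 4 * r < R) (hrx : r < dist p x)
    {c y : ℝ → M} (hc : Tendsto c (𝓝[>] 0) (𝓝 p))
    (hy : ∀ᶠ t in 𝓝[>] 0, dist (c t) (y t) = r ∧ dist (y t) x = dist (c t) x - r) :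
    Tendsto y (𝓝[>] 0) (𝓝 (σ r)) := by
  have hk := hM.pos
  have e₁ := hσ.dist_left ⟨hr.le, hrx.le⟩
  have e₂ := hσ.dist_right ⟨hr.le, hrx.le⟩
  have l₁ : Tendsto (fun t => dist (c t) x) (𝓝[>] 0) (𝓝 (dist p x)) := hc.dist tendsto_const_nhds
  have l₂ : Tendsto (fun t => dist (σ r) (c t)) (𝓝[>] 0) (𝓝 r) := by
    have := (tendsto_const_nhds (x := σ r)).dist hc
    rwa [dist_comm (σ r) p, e₁] at this
  have hsin := hM.sin_pos (dist_pos.2 fun h => by rw [h, dist_self] at hrx; linarith) hR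
  have hcos : ∀ {f : ℝ → ℝ} {a : ℝ}, Tendsto f (𝓝[>] 0) (𝓝 a) →
      Tendsto (fun t => Real.cos (k * f t)) (𝓝[>] 0) (𝓝 (Real.cos (k * a))) := fun h =>
    (Real.continuous_cos.tendsto _).comp (h.const_mul k)
  have hsin' : ∀ {f : ℝ → ℝ} {a : ℝ}, Tendsto f (𝓝[>] 0) (𝓝 a) →
      Tendsto (fun t => Real.sin (k * f t)) (𝓝[>] 0) (𝓝 (Real.sin (k * a))) := fun h =>
    (Real.continuous_sin.tendsto _).comp (h.const_mul k)
  have hq := ((((hsin' (l₁.sub_const r)).mul (hcos l₂)).add_const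
    (Real.sin (k * r) * Real.cos (k * (dist p x - r)))).div (hsin' l₁) hsin.ne')
  have hone : (Real.sin (k * (dist p x - r)) * Real.cos (k * r) +
      Real.sin (k * r) * Real.cos (k * (dist p x - r))) / Real.sin (k * dist p x) = 1 := by
    rw [mul_comm (Real.sin (k * r)), ← Real.sin_add, ← mul_add, sub_add_cancel,
      div_self hsin.ne']
  rw [hone] at hq
  have hq' := ((Real.continuous_arccos.tendsto _).comp hq).div_const k
  rw [Real.arccos_one, zero_div] at hq'
  rw [tendsto_iff_dist_tendsto_zero]
  refine squeeze_zero' (Eventually.of_forall fun _ => dist_nonneg) ?_ hq'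
  have lsum := (l₁.add_const (dist p x - r)).add l₂
  filter_upwards [hy, lsum.eventually_lt_const (show dist p x + (dist p x - r) + r < R by linarith),
    (l₂.add_const r).eventually_lt_const (show r + r < R / 2 by linarith),
    (hsin' l₁).eventually_const_lt hsin] with t ⟨h₁, h₂⟩ h₃ h₄ h₅
  have hs := hM.stewart (c t) x (σ r) (y t) 
    (by rw [dist_comm x (σ r), e₂, dist_comm (c t) (σ r)]; exact h₃) (by rw [h₁, h₂]; ring)
  rw [h₁, h₂, e₂] at hs
  have hle : k * dist (y t) (σ r) ≤ Real.pi := by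
    have t₁ := dist_triangle (σ r) (c t) (y t)
    rw [h₁] at t₁
    have : k * (2 * dist (σ r) (y t)) ≤ k * R := by gcongr; linarith
    rw [dist_comm]
    linarith [hM.mul_le]
  rw [Function.comp, le_div_iff₀ hk, mul_comm,
    ← Real.arccos_cos (x := k * dist (y t) (σ r)) (by positivity) hle]
  refine Real.arccos_le_arccos ?_
  rw [Pi.div_apply, div_le_iff₀ h₅, dist_comm (y t)]
  linarith

/-- The lower bound in the first variation formula: moving along `γ` with unit speed, the distance
to `x` decreases at most at the rate given by the cosine of the angle to the shortest path `σ` from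
`p` to `x`, provided that the shortest paths from `γ t` to `x` start off close to `σ`. -/
theorem eventually_le_dist_sub_div (hM : HasSphericalComparison k R M) (γ : UnitGeodesic p)
    {x : M} {σ : ℝ → M} (hσ : IsShortestPath σ p x) (hx : p ≠ x) {r : ℝ} (hr : 0 < r)
    (hrR : 4 * r < R) (hrx : r < dist p x) {y : ℝ → M}
    (hy : ∀ᶠ t in 𝓝[>] 0,
      dist (γ.toFun t) (y t) = r ∧ dist (y t) x = dist (γ.toFun t) x - r)
    (hlim : Tendsto y (𝓝[>] 0) (𝓝 (σ r))) {ε : ℝ} (hε : 0 < ε) :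
    ∀ᶠ t in 𝓝[>] 0, -Real.cos (geodesicAngle γ (hσ.toUnitGeodesic hx)) - ε ≤
      (dist (γ.toFun t) x - dist p x) / t := by
  have hk := hM.pos
  have e₁ := hσ.dist_left ⟨hr.le, hrx.le⟩
  have hid : Tendsto (fun t : ℝ => t) (𝓝[>] 0) (𝓝 0) := nhdsWithin_le_nhds
  have l₁ : Tendsto (fun t => dist p (y t)) (𝓝[>] 0) (𝓝 r) := by
    have := (tendsto_const_nhds (x := p)).dist hlim
    rwa [e₁] at this
  have l₂ : Tendsto (fun t => dist (σ r) (y t)) (𝓝[>] 0) (𝓝 0) := by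
    have := (tendsto_const_nhds (x := σ r)).dist hlim
    rwa [dist_self] at this
  have hsr := hM.sin_pos hr (by linarith)
  have hcos : ∀ {f : ℝ → ℝ} {a : ℝ}, Tendsto f (𝓝[>] 0) (𝓝 a) →
      Tendsto (fun t => Real.cos (k * f t)) (𝓝[>] 0) (𝓝 (Real.cos (k * a))) := fun h =>
    (Real.continuous_cos.tendsto _).comp (h.const_mul k)
  have hsin : ∀ {f : ℝ → ℝ} {a : ℝ}, Tendsto f (𝓝[>] 0) (𝓝 a) →
      Tendsto (fun t => Real.sin (k * f t)) (𝓝[>] 0) (𝓝 (Real.sin (k * a))) := fun h =>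
    (Real.continuous_sin.tendsto _).comp (h.const_mul k)
  have hsinc : ∀ {f : ℝ → ℝ}, Tendsto f (𝓝[>] 0) (𝓝 0) →
      Tendsto (fun t => |1 - Real.sinc (k * f t)|) (𝓝[>] 0) (𝓝 0) := fun h => by
    have := (((Real.continuous_sinc.tendsto _).comp (h.const_mul k)).const_sub 1).abs
    simpa using this
  -- `β` bounds the angle between `σ` and the shortest path from `p` to `y t`.
  obtain ⟨β, hβ⟩ : ∃ β : ℝ → ℝ, β = fun t => Real.arccos
    ((Real.cos (k * dist (σ r) (y t)) - Real.cos (k * r) * Real.cos (k * dist p (y t))) /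
      (Real.sin (k * r) * Real.sin (k * dist p (y t)))) := ⟨_, rfl⟩
  have hβ0 : Tendsto β (𝓝[>] 0) (𝓝 0) := by
    have h := ((hcos l₂).sub ((hcos l₁).const_mul (Real.cos (k * r)))).div
      ((hsin l₁).const_mul (Real.sin (k * r))) (by positivity)
    have hone : (Real.cos (k * 0) - Real.cos (k * r) * Real.cos (k * r)) /
        (Real.sin (k * r) * Real.sin (k * r)) = 1 := by
      rw [div_eq_one_iff_eq (by positivity), mul_zero, Real.cos_zero]
      linarith [Real.sin_sq_add_cos_sq (k * r)]
    rw [hone] at h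
    have h' := (Real.continuous_arccos.tendsto _).comp h
    rw [Real.arccos_one] at h'
    rw [hβ]
    exact h'
  have hδ : Tendsto (fun t => dist p (y t) - r) (𝓝[>] 0) (𝓝 0) := by
    have := l₁.sub_const r
    rwa [sub_self] at this
  have herr := (((hsinc hδ).add (hsinc hid)).add
    ((hid.const_mul k).div ((hsin l₁).const_mul 2) (by positivity))).add hβ0
  simp only [mul_zero, zero_div, add_zero] at herr
  filter_upwards [hy, γ.eventually_isometricUpTo, herr.eventually_lt_const hε,
    l₁.eventually_const_lt hr, l₁.eventually_lt_const (show r < R / 4 by linarith),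
    l₂.eventually_lt_const (show 0 < R / 4 by linarith),
    hid.eventually_lt_const (show 0 < R / 4 by linarith)]
    with t ⟨h₁, h₂⟩ ⟨ht, hγ, hγt⟩ herr he0 heR hqR htR
  obtain ⟨τ, hτ⟩ := hM.exists_shortestPath p (y t) (by linarith)
  have hne : p ≠ y t := dist_pos.1 he0
  have hse := hM.sin_pos he0 (by linarith)
  have a₁ := hM.cos_dist_le (γ₁ := γ) (γ₂ := hτ.toUnitGeodesic hne) hγ hτ.isom ht he0 (by
    change t + dist p (y t) + dist (γ.toFun t) (τ (dist p (y t))) < R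
    rw [hτ.target, h₁]; linarith)
  have a₂ := hM.cos_dist_le (γ₁ := hσ.toUnitGeodesic hx) (γ₂ := hτ.toUnitGeodesic hne)
    (IsometricUpTo.mono hσ.isom hrx.le) hτ.isom hr he0 (by
      change r + dist p (y t) + dist (σ r) (τ (dist p (y t))) < R
      rw [hτ.target]; linarith)
  change Real.cos (k * dist (γ.toFun t) (τ (dist p (y t)))) ≤ _ at a₁
  change Real.cos (k * dist (σ r) (τ (dist p (y t)))) ≤ _ at a₂
  rw [hτ.target, h₁] at a₁
  rw [hτ.target] at a₂
  have hβle : geodesicAngle (hσ.toUnitGeodesic hx) (hτ.toUnitGeodesic hne) ≤ β t := by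
    rw [hβ, ← Real.arccos_cos (geodesicAngle_nonneg (hσ.toUnitGeodesic hx) (hτ.toUnitGeodesic hne))
      (geodesicAngle_le_pi _ _)]
    refine Real.arccos_le_arccos ?_
    rw [div_le_iff₀ (by positivity)]
    linarith
  have htri := geodesicAngle_triangle γ (hτ.toUnitGeodesic hne) (hσ.toUnitGeodesic hx)
  rw [geodesicAngle_comm (hτ.toUnitGeodesic hne)] at htri
  have hcosα : Real.cos (geodesicAngle γ (hτ.toUnitGeodesic hne)) ≤
      Real.cos (geodesicAngle γ (hσ.toUnitGeodesic hx)) + β t := by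
    rcases le_total (geodesicAngle γ (hσ.toUnitGeodesic hx))
      (geodesicAngle γ (hτ.toUnitGeodesic hne)) with hle | hle
    · have h₀ := geodesicAngle_nonneg (hσ.toUnitGeodesic hx) (hτ.toUnitGeodesic hne)
      linarith [Real.cos_le_cos_of_nonneg_of_le_pi (geodesicAngle_nonneg _ _)
        (geodesicAngle_le_pi _ _) hle]
    · have := (abs_le.1 (Real.abs_cos_sub_cos_le (geodesicAngle γ (hτ.toUnitGeodesic hne))
        (geodesicAngle γ (hσ.toUnitGeodesic hx)))).2
      rw [abs_sub_comm, abs_of_nonneg (by linarith)] at this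
      linarith
  generalize geodesicAngle γ (hτ.toUnitGeodesic hne) = α at *
  generalize geodesicAngle γ (hσ.toUnitGeodesic hx) = θ at *
  obtain ⟨e, he⟩ : ∃ e, e = dist p (y t) := ⟨_, rfl⟩
  rw [← he] at a₁ he0 heR hse herr
  have hδt : |e - r| ≤ t := by
    have t₁ := dist_triangle p (γ.toFun t) (y t)
    have t₂ := dist_triangle_left (γ.toFun t) (y t) p
    rw [abs_le]
    constructor <;> linarith
  obtain ⟨d, hd⟩ : ∃ d, d = e - r := ⟨_, rfl⟩
  rw [← hd] at hδt herr
  have hcosd : Real.cos (k * t) ≤ Real.cos (k * d) := by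
    rw [← Real.cos_abs (k * d), abs_mul, abs_of_pos hk]
    refine Real.cos_le_cos_of_nonneg_of_le_pi (by positivity) ?_ (by gcongr)
    have : k * (2 * t) ≤ k * R := by gcongr; linarith
    linarith [hM.mul_le]
  have hcosr : Real.cos (k * r) = Real.cos (k * e) * Real.cos (k * d) +
      Real.sin (k * e) * Real.sin (k * d) := by
    rw [← Real.cos_sub, hd]
    congr 1
    ring
  have hquad : Real.cos (k * e) * (Real.cos (k * t) - Real.cos (k * d)) ≤ (k * t) ^ 2 / 2 := by
    have q₁ := Real.one_sub_sq_div_two_le_cos (x := k * t)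
    have q₂ := Real.cos_le_one (k * d)
    nlinarith [Real.neg_one_le_cos (k * e)]
  have hmain : Real.sin (k * e) * Real.sin (k * d) ≤
      Real.sin (k * e) * (Real.sin (k * t) * Real.cos α) + (k * t) ^ 2 / 2 := by linarith
  have hsinc' : ∀ x : ℝ, Real.sin x = x * Real.sinc x := fun x => by
    by_cases hx : x = 0
    · simp [hx]
    · rw [Real.sinc_of_ne_zero hx]; field_simp
  rw [hsinc' (k * d), hsinc' (k * t)] at hmain
  have hdiv : d / t * Real.sinc (k * d) ≤
      Real.sinc (k * t) * Real.cos α + k * t / (2 * Real.sin (k * e)) := by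
    refine le_of_mul_le_mul_left ?_ (show 0 < Real.sin (k * e) * (k * t) by positivity)
    calc _ = Real.sin (k * e) * (k * d * Real.sinc (k * d)) := by field_simp
      _ ≤ _ := hmain
      _ = _ := by field_simp
  have hdt : |d / t| ≤ 1 := by rwa [abs_div, abs_of_pos ht, div_le_one ht]
  have p₁ : d / t * (1 - Real.sinc (k * d)) ≤ |1 - Real.sinc (k * d)| := by
    refine (le_abs_self _).trans ?_
    rw [abs_mul]
    exact mul_le_of_le_one_left (abs_nonneg _) hdt
  have p₂ : -(Real.cos α * (1 - Real.sinc (k * t))) ≤ |1 - Real.sinc (k * t)| := by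
    refine (neg_le_abs _).trans ?_
    rw [abs_mul]
    exact mul_le_of_le_one_left (abs_nonneg _) (Real.abs_cos_le_one _)
  have hfin : -(d / t) ≤ (dist (γ.toFun t) x - dist p x) / t := by
    rw [← neg_div]
    gcongr
    have := dist_triangle p (y t) x
    linarith
  rw [Pi.div_apply, ← he] at herr
  linarith

end HasSphericalComparison

/-- The points at distance `r` from the start of shortest paths to a common endpoint `x`. -/
theorem exists_shortestPath_points {c : ℝ → M} {x : M} (hc : Tendsto c (𝓝[>] 0) (𝓝 p))
    (hpath : ∀ᶠ t in 𝓝[>] 0, ∃ τ : ℝ → M, IsShortestPath τ (c t) x) {r : ℝ} (hr : 0 ≤ r)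
    (hrx : r < dist p x) :
    ∃ y : ℝ → M, ∀ᶠ t in 𝓝[>] 0, dist (c t) (y t) = r ∧ dist (y t) x = dist (c t) x - r := by
  have h : ∀ᶠ t in 𝓝[>] 0, ∃ y : M, dist (c t) y = r ∧ dist y x = dist (c t) x - r := by
    have l : Tendsto (fun t => dist (c t) x) (𝓝[>] 0) (𝓝 (dist p x)) :=
      hc.dist tendsto_const_nhds
    filter_upwards [hpath, l.eventually_const_lt hrx] with t ⟨τ, hτ⟩ ht
    exact ⟨τ r, hτ.dist_left ⟨hr, ht.le⟩, hτ.dist_right ⟨hr, ht.le⟩⟩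
  exact h.choice

namespace HasSphericalComparison

theorem first_variation_of_dist_lt (hM : HasSphericalComparison k R M) (γ : UnitGeodesic p)
    {x : M} {σ : ℝ → M} (hσ : IsShortestPath σ p x) (hx : p ≠ x) (hR : 2 * dist p x < R) {ε : ℝ}
    (hε : 0 < ε) :
    ∀ᶠ t in 𝓝[>] 0, -Real.cos (geodesicAngle γ (hσ.toUnitGeodesic hx)) - ε ≤
      (dist (γ.toFun t) x - dist p x) / t := by
  have hd := dist_pos.2 hx
  have hRpos := hM.radius_pos
  obtain ⟨r, hr⟩ : ∃ r, r = min (R / 8) (dist p x / 2) := ⟨_, rfl⟩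
  have r₀ : 0 < r := by rw [hr]; positivity
  have r₁ : r ≤ R / 8 := hr ▸ min_le_left _ _
  have r₂ : r ≤ dist p x / 2 := hr ▸ min_le_right _ _
  have l : Tendsto (fun t => dist (γ.toFun t) x) (𝓝[>] 0) (𝓝 (dist p x)) :=
    γ.tendsto_source.dist tendsto_const_nhds
  obtain ⟨y, hy⟩ := exists_shortestPath_points γ.tendsto_source
    ((l.eventually_lt_const (show dist p x < R / 2 by linarith)).mono fun t ht =>
      hM.exists_shortestPath _ _ ht) r₀.le (show r < dist p x by linarith)
  exact hM.eventually_le_dist_sub_div γ hσ hx r₀ (by linarith) (by linarith) hy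
    (hM.tendsto_shortestPath_point hσ hR r₀ (by linarith) (by linarith) γ.tendsto_source hy) hε

/-- In a locally compact geodesic space no bound on the distance to `x` is needed, if the shortest
path to `x` is unique: shortest paths from nearby points to `x` can only accumulate at it. -/
theorem first_variation_of_unique (hM : HasSphericalComparison k R M) [LocallyCompactSpace M]
    (hgeo : IsGeodesicSpace M) (γ : UnitGeodesic p) {x : M} {σ : ℝ → M}
    (hσ : IsShortestPath σ p x) (hx : p ≠ x) (hu : HasUniqueShortestPath p x) {ε : ℝ}
    (hε : 0 < ε) :
    ∀ᶠ t in 𝓝[>] 0, -Real.cos (geodesicAngle γ (hσ.toUnitGeodesic hx)) - ε ≤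
      (dist (γ.toFun t) x - dist p x) / t := by
  have hd := dist_pos.2 hx
  have hRpos := hM.radius_pos
  obtain ⟨K, hK, hKp⟩ := exists_compact_mem_nhds p
  obtain ⟨ρ, hρ, hball⟩ := Metric.mem_nhds_iff.1 hKp
  obtain ⟨r, hr⟩ : ∃ r, r = min (min (R / 8) (dist p x / 2)) (ρ / 2) := ⟨_, rfl⟩
  have r₀ : 0 < r := by rw [hr]; positivity
  have r₁ : r ≤ R / 8 := hr ▸ (min_le_left _ _).trans (min_le_left _ _)
  have r₂ : r ≤ dist p x / 2 := hr ▸ (min_le_left _ _).trans (min_le_right _ _)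
  have r₃ : r ≤ ρ / 2 := hr ▸ min_le_right _ _
  obtain ⟨y, hy⟩ := exists_shortestPath_points (x := x) γ.tendsto_source
    (Eventually.of_forall fun t => hgeo _ _) r₀.le (show r < dist p x by linarith)
  refine hM.eventually_le_dist_sub_div γ hσ hx r₀ (by linarith) (by linarith) hy ?_ hε
  have hid : Tendsto (fun t : ℝ => t) (𝓝[>] 0) (𝓝 0) := nhdsWithin_le_nhds
  have l₁ : Tendsto (fun t => dist p (y t)) (𝓝[>] 0) (𝓝 r) := by
    rw [tendsto_iff_dist_tendsto_zero]
    refine squeeze_zero' (Eventually.of_forall fun _ => dist_nonneg) ?_ hid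
    filter_upwards [hy, γ.eventually_isometricUpTo] with t ⟨h₁, _⟩ ⟨_, _, h₂⟩
    have t₁ := dist_triangle p (γ.toFun t) (y t)
    have t₂ := dist_triangle_left (γ.toFun t) (y t) p
    rw [Real.dist_eq, abs_le]
    constructor <;> linarith
  have l₂ : Tendsto (fun t => dist (y t) x) (𝓝[>] 0) (𝓝 (dist p x - r)) := by
    have : Tendsto (fun t => dist (γ.toFun t) x - r) (𝓝[>] 0) (𝓝 (dist p x - r)) :=
      (γ.tendsto_source.dist tendsto_const_nhds).sub_const r
    exact this.congr' (hy.mono fun t ht => ht.2.symm)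
  refine hK.tendsto_nhds_of_unique_mapClusterPt ?_ fun z _ hz => ?_
  · filter_upwards [l₁.eventually_lt_const (show r < ρ by linarith)] with t ht
    exact hball (Metric.mem_ball'.2 ht)
  · have cluster : ∀ {f : M → ℝ} {a : ℝ}, Continuous f →
        Tendsto (fun t => f (y t)) (𝓝[>] 0) (𝓝 a) → f z = a := fun {f a} hf ha => by
      have h₁ : MapClusterPt (f z) (𝓝[>] 0) (f ∘ y) := hz.continuousAt_comp hf.continuousAt
      have h₂ : NeBot (𝓝 (f z) ⊓ 𝓝 a) := NeBot.mono h₁ (inf_le_inf_left _ ha)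
      exact eq_of_nhds_neBot h₂
    have e₁ : dist p z = r := cluster (continuous_const.dist continuous_id) l₁
    have e₂ : dist z x = dist p x - r := cluster (continuous_id.dist continuous_const) l₂
    obtain ⟨α, hα⟩ := hgeo p z
    obtain ⟨β, hβ⟩ := hgeo z x
    obtain ⟨σ', hσ', hz'⟩ := exists_isShortestPath_through hα hβ (by rw [e₁, e₂]; ring)
    obtain ⟨σ₀, -, hσ₀⟩ := hu
    have hmem : r ∈ Icc 0 (dist p x) := ⟨r₀.le, by linarith⟩
    rw [← hz', e₁, hσ₀ σ' hσ' hmem, hσ₀ σ hσ hmem]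

end HasSphericalComparison

/-- The lower bound in the first variation formula holds for the distance to `x` along all geodesics
from `b`: the distance decreases at most at the rate given by the cosine of the angle to any shortest
path from `b` to `x`. -/
def FirstVariationAt (b x : M) : Prop :=
  ∀ (σ : ℝ → M) (hσ : IsShortestPath σ b x) (hx : b ≠ x) (γ : UnitGeodesic b) (ε : ℝ), 0 < ε →
    ∀ᶠ t in 𝓝[>] 0, -Real.cos (geodesicAngle γ (hσ.toUnitGeodesic hx)) - ε ≤
      (dist (γ.toFun t) x - dist b x) / t

/-- The direction of a geodesic. -/
def UnitGeodesic.direction (γ : UnitGeodesic p) : Direction p := Quotient.mk (directionSetoid p) γ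

/-- The unit tangent vector at the start of a geodesic. -/
noncomputable def UnitGeodesic.velocity (γ : UnitGeodesic p) : TangentCone p := TangentCone.mk γ.direction 1

/-- The lower bound in the first variation formula for half of the squared distance. -/
theorem FirstVariationAt.eventually_le {b x : M} (h : FirstVariationAt b x)
    (hpath : ∃ σ : ℝ → M, IsShortestPath σ b x) (γ : UnitGeodesic b) {ε : ℝ} (hε : 0 < ε) :
    ∀ᶠ t in 𝓝[>] 0,
      -(logMap b x).inner γ.velocity - ε ≤
        (dist (γ.toFun t) x ^ 2 - dist b x ^ 2) / (2 * t) := by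
  have hpos : ∀ᶠ t : ℝ in 𝓝[>] 0, 0 < t := self_mem_nhdsWithin
  by_cases hx : b = x
  · subst hx
    rw [logMap, dif_neg (fun h => h.1 rfl), TangentCone.inner_apex_left]
    filter_upwards [hpos] with t ht
    rw [dist_self]
    have : 0 ≤ (dist (γ.toFun t) b ^ 2 - 0 ^ 2) / (2 * t) := by
      rw [zero_pow two_ne_zero, sub_zero]; positivity
    linarith
  · have hd := dist_pos.2 hx
    have hσ := Classical.choose_spec hpath
    have hlog : logMap b x = TangentCone.mk (hσ.toUnitGeodesic hx).direction (dist b x) :=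
      dif_pos ⟨hx, hpath⟩
    have hinner : (logMap b x).inner γ.velocity =
        dist b x * Real.cos (geodesicAngle (hσ.toUnitGeodesic hx) γ) := by
      rw [hlog, UnitGeodesic.velocity, TangentCone.inner_mk_mk hd one_pos, mul_one]
      rfl
    rw [hinner]
    have hvar := h _ hσ hx γ (ε / dist b x) (by positivity)
    rw [geodesicAngle_comm] at hvar
    filter_upwards [hvar, hpos] with t ht ht0
    have h₁ := mul_le_mul_of_nonneg_left ht hd.le
    rw [mul_sub, mul_div_cancel₀ _ hd.ne'] at h₁
    have h₂ : (dist (γ.toFun t) x ^ 2 - dist b x ^ 2) / (2 * t) =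
        dist b x * ((dist (γ.toFun t) x - dist b x) / t) +
          (dist (γ.toFun t) x - dist b x) ^ 2 / (2 * t) := by field_simp; ring
    have h₃ : 0 ≤ (dist (γ.toFun t) x - dist b x) ^ 2 / (2 * t) := by positivity
    rw [h₂]
    linarith

/-! ### The Fréchet function along opposite directions -/

theorem UnitGeodesic.eventually_abs_dist_sq_sub_le {b : M} (γ : UnitGeodesic b) :
    ∀ᶠ t in 𝓝[>] 0, ∀ x, |(dist (γ.toFun t) x ^ 2 - dist b x ^ 2) / (2 * t)| ≤
      dist b x ^ 2 + 2 := by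
  have h1 : ∀ᶠ t : ℝ in 𝓝[>] 0, t < 1 := nhdsWithin_le_nhds (Iio_mem_nhds one_pos)
  filter_upwards [γ.eventually_isometricUpTo, h1] with t ⟨ht, _, hγt⟩ ht1 x
  have t₁ := dist_triangle b (γ.toFun t) x
  have t₂ := dist_triangle_left (γ.toFun t) x b
  rw [hγt] at t₁ t₂
  have n₁ : 0 ≤ dist b x := dist_nonneg
  have n₂ : 0 ≤ dist (γ.toFun t) x := dist_nonneg
  rw [abs_le, le_div_iff₀ (by positivity), div_le_iff₀ (by positivity)]
  generalize dist (γ.toFun t) x = d at *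
  generalize dist b x = e at *
  have k₁ : d ^ 2 ≤ (e + t) ^ 2 := by gcongr; linarith
  have k₂ : e ^ 2 ≤ (d + t) ^ 2 := by gcongr; linarith
  constructor <;> nlinarith [mul_nonneg ht.le (sq_nonneg (e - 1)), mul_pos ht ht,
    mul_nonneg ht.le (sub_nonneg.2 ht1.le)]

/-- A closed set that contains almost every value of the (possibly non-measurable) map `f` contains
the support of the pushforward under `f`, which is zero if `f` is not measurable. -/
theorem support_map_subset {Ω α : Type*} [MeasurableSpace Ω] {μ : Measure Ω} [TopologicalSpace α]
    [MeasurableSpace α]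
    [OpensMeasurableSpace α] {f : Ω → α} {K : Set α} (hK : IsClosed K)
    (h : ∀ᵐ x ∂μ, f x ∈ K) : (μ.map f).support ⊆ K := by
  intro a ha
  by_contra haK
  have hpos := (Measure.mem_support_iff_forall a).1 ha _ (hK.isOpen_compl.mem_nhds haK)
  by_cases hf : AEMeasurable f μ
  · rw [Measure.map_apply_of_aemeasurable hf hK.isOpen_compl.measurableSet] at hpos
    exact hpos.ne' h
  · rw [Measure.map_of_not_aemeasurable hf] at hpos
    exact hpos.ne' rfl

section Measure

variable [MeasurableSpace M] {μ : Measure M}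

/-- If the Fréchet function has derivative `0` along `γ`, then so has the integral of the difference
quotients of half of the squared distance. -/
theorem tendsto_integral_dist_sq_sub {b : M} (γ : UnitGeodesic b)
    (hint : ∀ q, Integrable (fun x => dist q x ^ 2) μ)
    (hγ : HasDerivWithinAt (fun t : ℝ => frechet μ (γ.toFun (t * 1))) 0 (Ici 0) 0) :
    Tendsto (fun t => ∫ x, (dist (γ.toFun t) x ^ 2 - dist b x ^ 2) / (2 * t) ∂μ)
      (𝓝[>] 0) (𝓝 0) := by
  rw [← hasDerivWithinAt_Ioi_iff_Ici, hasDerivWithinAt_iff_tendsto_slope' self_notMem_Ioi] at hγ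
  refine hγ.congr' ?_
  filter_upwards [self_mem_nhdsWithin] with t ht
  have ht0 : 0 < t := ht
  rw [integral_div, integral_sub (hint _) (hint _), slope_def_field]
  simp only [frechet, mul_one, sub_zero]
  rw [γ.source]
  field_simp

/-- Along two opposite directions with vanishing directional derivatives of the Fréchet function,
the first variation formula is sharp at almost every point. -/
theorem ae_inner_add_inner_eq_zero [BorelSpace M] [IsProbabilityMeasure μ] {b : M}
    (hint : ∀ q, Integrable (fun x => dist q x ^ 2) μ)
    (hvar : ∀ᵐ x ∂μ, FirstVariationAt b x ∧ ∃ σ : ℝ → M, IsShortestPath σ b x)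
    {γ₁ γ₂ : UnitGeodesic b}
    (h₁ : HasDerivWithinAt (fun t : ℝ => frechet μ (γ₁.toFun (t * 1))) 0 (Ici 0) 0)
    (h₂ : HasDerivWithinAt (fun t : ℝ => frechet μ (γ₂.toFun (t * 1))) 0 (Ici 0) 0)
    (hnonpos : ∀ W : TangentCone b,
      W.inner γ₁.velocity +
        W.inner γ₂.velocity ≤ 0) :
    ∀ᵐ x ∂μ, (logMap b x).inner γ₁.velocity +
      (logMap b x).inner γ₂.velocity = 0 := by
  obtain ⟨u, hu⟩ := exists_seq_tendsto (𝓝[>] (0 : ℝ))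
  have hbd := hu.eventually
    (γ₁.eventually_abs_dist_sq_sub_le.and γ₂.eventually_abs_dist_sq_sub_le)
  obtain ⟨H, hH⟩ : ∃ H : ℕ → M → ℝ, H = fun n x =>
    (dist (γ₁.toFun (u n)) x ^ 2 - dist b x ^ 2) / (2 * u n) +
      (dist (γ₂.toFun (u n)) x ^ 2 - dist b x ^ 2) / (2 * u n) := ⟨_, rfl⟩
  have hHint : ∀ n, Integrable (H n) μ := fun n => by
    rw [hH]
    exact (((hint _).sub (hint _)).div_const _).add (((hint _).sub (hint _)).div_const _)
  have hH0 : Tendsto (fun n => ∫ x, H n x ∂μ) atTop (𝓝 0) := by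
    have := ((tendsto_integral_dist_sq_sub γ₁ hint h₁).comp hu).add
      ((tendsto_integral_dist_sq_sub γ₂ hint h₂).comp hu)
    rw [add_zero] at this
    refine this.congr fun n => ?_
    rw [hH]
    exact (integral_add (((hint _).sub (hint _)).div_const _)
      (((hint _).sub (hint _)).div_const _)).symm
  have hlow : ∀ᵐ x ∂μ, ∀ ε > 0, ∀ᶠ n in atTop,
      -((logMap b x).inner γ₁.velocity +
        (logMap b x).inner γ₂.velocity) - ε ≤ H n x := by
    filter_upwards [hvar] with x ⟨hx, hσ⟩ ε hε
    filter_upwards [hu.eventually (hx.eventually_le hσ γ₁ (half_pos hε)),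
      hu.eventually (hx.eventually_le hσ γ₂ (half_pos hε))] with n k₁ k₂
    rw [hH]
    linarith
  -- The negative parts tend to zero by dominated convergence, hence `H n` tends to zero in `L¹`.
  have hneg : Tendsto (fun n => ∫ x, max (-H n x) 0 ∂μ) atTop (𝓝 0) := by
    have := tendsto_integral_filter_of_dominated_convergence (μ := μ) (l := atTop)
      (F := fun n x => max (-H n x) 0) (f := fun _ => (0 : ℝ))
      (fun x => 2 * (dist b x ^ 2 + 2))
      (Eventually.of_forall fun n => (hHint n).neg.pos_part.aestronglyMeasurable) ?_
      (((hint b).add (integrable_const 2)).const_mul 2) ?_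
    · simpa using this
    · filter_upwards [hbd] with n ⟨b₁, b₂⟩
      refine Eventually.of_forall fun x => ?_
      have k₁ := abs_le.1 (b₁ x)
      have k₂ := abs_le.1 (b₂ x)
      rw [Real.norm_of_nonneg (le_max_right _ _), hH]
      refine max_le ?_ (by positivity)
      linarith [k₁.1, k₂.1]
    · filter_upwards [hlow] with x hx
      rw [Metric.tendsto_nhds]
      intro ε hε
      filter_upwards [hx (ε / 2) (half_pos hε)] with n hn
      have := hnonpos (logMap b x)
      rw [Real.dist_eq, sub_zero, abs_of_nonneg (le_max_right _ _)]
      exact max_lt (by linarith) hε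
  have habs : Tendsto (fun n => ∫ x, ‖H n x‖ ∂μ) atTop (𝓝 0) := by
    have := hH0.add (hneg.const_mul 2)
    rw [mul_zero, add_zero] at this
    refine this.congr fun n => ?_
    have hpos : Integrable (fun x => 2 * max (-H n x) 0) μ :=
      (hHint n).neg.pos_part.const_mul 2
    rw [← integral_const_mul, ← integral_add (hHint n) hpos]
    congr 1
    funext x
    rw [Real.norm_eq_abs]
    rcases le_total 0 (H n x) with h | h
    · rw [abs_of_nonneg h, max_eq_right (by linarith)]; ring
    · rw [abs_of_nonpos h, max_eq_left (by linarith)]; ring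
  have hmeas : TendstoInMeasure μ H atTop fun _ => (0 : ℝ) := by
    refine tendstoInMeasure_of_tendsto_eLpNorm one_ne_zero
      (fun n => (hHint n).aestronglyMeasurable) aestronglyMeasurable_const ?_
    have h := (ENNReal.continuous_ofReal.tendsto 0).comp habs
    rw [ENNReal.ofReal_zero] at h
    refine h.congr fun n => ?_
    rw [eLpNorm_one_eq_lintegral_enorm, Function.comp,
      ofReal_integral_norm_eq_lintegral_enorm (hHint n)]
    simp
  obtain ⟨ns, hns, hae⟩ := hmeas.exists_seq_tendsto_ae
  filter_upwards [hae, hlow] with x hx hlow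
  refine le_antisymm (hnonpos _) (le_of_forall_pos_le_add fun ε hε => ?_)
  have := ge_of_tendsto hx (hns.tendsto_atTop.eventually (hlow ε hε))
  linarith

/-- A unit vector in the escape cone is represented by a geodesic along which the derivative of the
Fréchet function vanishes. -/
theorem exists_geodesic_of_mem_escapeCone {b : M} {Z : TangentCone b} (hZ : Z.length = 1)
    (hZE : Z ∈ escapeCone μ b) :
    ∃ γ : UnitGeodesic b, Z = γ.velocity ∧
      HasDerivWithinAt (fun t : ℝ => frechet μ (γ.toFun (t * 1))) 0 (Ici 0) 0 := by
  obtain rfl | ⟨v, r, hr, rfl⟩ := Z.eq_apex_or_mk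
  · exact absurd hZ (by simp [TangentCone.apex, TangentCone.length])
  rw [TangentCone.length_mk hr] at hZ
  subst hZ
  change HasDirDeriv _ _ _ at hZE
  rw [TangentCone.mk_of_pos hr] at hZE
  obtain ⟨γ, hγ, h⟩ := hZE
  exact ⟨γ, by rw [← hγ]; rfl, h⟩

end Measure

end FrechetGeometry

theorem propositionp {M : Type*} [MetricSpace M] [MeasurableSpace M] [BorelSpace M]
    (κ : ℝ) (hM : FrechetGeometry.IsCAT κ M)
    (μ : MeasureTheory.Measure M) [MeasureTheory.IsProbabilityMeasure μ]
    (hμ : FrechetGeometry.IsLocalized μ)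
    (b : M) (hb : FrechetGeometry.IsFrechetMean μ b)
    (hreg : (CompleteSpace M ∧ LocallyCompactSpace M ∧ FrechetGeometry.IsGeodesicSpace M) ∨
      ∀ᵐ x ∂μ, 0 < κ → dist b x < Real.pi / √κ)
    (Z : FrechetGeometry.TangentCone b) (hZ : Z.length = 1)
    (hZE : Z ∈ FrechetGeometry.escapeCone μ b) :
    {X : FrechetGeometry.TangentCone b | X ∈ FrechetGeometry.fluctuatingCone μ b ∧
      X.length = 1 ∧ Real.pi ≤ Z.angle X}.Subsingleton := by
  open FrechetGeometry in
  obtain ⟨k, R, -, hkR⟩ := hM.exists_hasSphericalComparison le_rfl fun hκ => by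
    have := Real.pi_pos
    positivity
  have hvar : ∀ᵐ x ∂μ, FirstVariationAt b x ∧ ∃ σ : ℝ → M, IsShortestPath σ b x := by
    rcases hreg with ⟨-, hloc, hgeo⟩ | hreg
    · filter_upwards [hμ.2 b hb] with x hu
      exact ⟨fun σ hσ hx γ ε hε => hkR.first_variation_of_unique hgeo γ hσ hx hu hε,
        hu.imp fun σ h => h.1⟩
    · filter_upwards [hμ.2 b hb, hreg] with x hu hx
      obtain ⟨k, R, hR, hkR⟩ := hM.exists_hasSphericalComparison dist_nonneg hx
      exact ⟨fun σ hσ hne γ ε hε => hkR.first_variation_of_dist_lt γ hσ hne hR hε,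
        hu.imp fun σ h => h.1⟩
  rintro X ⟨⟨hXE, -⟩, hX, hZX⟩ X' ⟨⟨-, hX'⟩, hX'1, hZX'⟩
  have hnonpos := TangentCone.inner_add_inner_nonpos hZ hX hZX
  obtain ⟨γ₁, rfl, h₁⟩ := exists_geodesic_of_mem_escapeCone hZ hZE
  obtain ⟨γ₂, rfl, h₂⟩ := exists_geodesic_of_mem_escapeCone hX hXE
  have hae := ae_inner_add_inner_eq_zero hb.1 hvar h₁ h₂ hnonpos
  have hclosed : IsClosed {W : TangentCone b | W.inner γ₁.velocity + W.inner γ₂.velocity = 0} :=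
    isClosed_eq ((TangentCone.continuous_inner_left _).add (TangentCone.continuous_inner_left _))
      continuous_const
  have hK := hX' _ ⟨TangentCone.isConvexCone_inner_add_inner_eq_zero hkR hnonpos,
    support_map_subset hclosed hae⟩
  rw [mem_ofPred_eq] at hK
  have hcos : X'.inner γ₁.velocity ≤ -1 := by
    have := TangentCone.inner_add_inner_nonpos hZ hX'1 hZX' X'
    have hself := TangentCone.dist_sq X' X'
    rw [dist_self] at hself
    rw [hX'1] at hself
    linarith
  rw [← dist_eq_zero, dist_comm, ← sq_eq_zero_iff]
  refine le_antisymm ?_ (sq_nonneg _)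
  rw [TangentCone.dist_sq, hX, hX'1]
  linarith
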